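/- Let $\psi:\mathbb R\to\mathbb R$ be Lipschitz continuous with $\psi<0$ on $(-\infty,0]\cup[1,\infty)$ and $\max_{[0,1]}\psi>0$, and let $\lambda\ge 0$. Let $A$ be the set of all curves $\gamma=(\gamma^1,\gamma^2)\in W^{2,2}(0,1;\mathbb R^2)$ (identified with their $C^1$ representatives on $[0,1]$) such that $\gamma'(x)\neq 0$ and $\gamma^2(x)\ge\psi(\gamma^1(x))$ for all $x\in[0,1]$, $\gamma(0)=(0,0)$ and $\gamma(1)=(1,0)$. For $\gamma\in A$ put $$\mathcal E_\lambda[\gamma]=\int_\gamma|\boldsymbol\kappa|^2\,ds+\lambda L[\gamma],\qquad \boldsymbol\kappa=\partial_s^2\gamma,\quad \partial_s=\tfrac{1}{|\gamma'|}\tfrac{d}{dx},\quad ds=|\gamma'|\,dx,\quad L[\gamma]=\int_\gamma ds .$$ Let $\gamma\in A$ be a local minimizer of $\mathcal E_\lambda$ in $A$ with respect to the $W^{2,2}(0,1)$-topology, that is, there is $\varepsilon>0$ such that $\mathcal E_\lambda[\gamma]\le\mathcal E_\lambda[\eta]$ for all $\eta\in A$ with $\|\eta-\gamma\|_{W^{2,2}(0,1)}<\varepsilon$.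 Put $L=L[\gamma]$ and let $\tilde\gamma:[0,L]\to\mathbb R^2$ be the arclength parametrization of $\gamma$. Then $\tilde\gamma\in W^{3,\infty}(0,L)$, and its signed curvature $k=\langle\tilde\gamma'',\boldsymbol n\rangle$, where $\boldsymbol n$ is $\tilde\gamma'$ rotated counterclockwise by $\pi/2$, lies in $W^{1,\infty}(0,L)$. -/

import Mathlib

open MeasureTheory Set
open scoped NNReal ENNReal

noncomputable section

namespace Elastica

/-! ### Sobolev spaces on an open interval -/

/-- `g` is the weak derivative of `f` on the interval `(a, b)`: both are locally integrable there, and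
`∫ φ' f = - ∫ φ g` for every test function `φ ∈ C_c^∞(a, b)`. -/
def HasWeakDeriv {E : Type*} [NormedAddCommGroup E] [NormedSpace ℝ E] (a b : ℝ) (f g : ℝ → E) :
    Prop :=
  LocallyIntegrableOn f (Ioo a b) ∧ LocallyIntegrableOn g (Ioo a b) ∧
    ∀ φ : ℝ → ℝ, ContDiff ℝ (⊤ : ℕ∞) φ → HasCompactSupport φ → tsupport φ ⊆ Ioo a b →
      ∫ x in Ioo a b, deriv φ x • f x = -∫ x in Ioo a b, φ x • g x

/-- `MemSobolev m p a b f` says that `f ∈ W^{m,p}(a, b)`: the function `f` and its weak derivatives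
up to order `m` lie in `L^p(a, b)`. -/
def MemSobolev {E : Type*} [NormedAddCommGroup E] [NormedSpace ℝ E] :
    ℕ → ℝ≥0∞ → ℝ → ℝ → (ℝ → E) → Prop
  | 0, p, a, b, f => MemLp f p (volume.restrict (Ioo a b))
  | m + 1, p, a, b, f =>
      MemLp f p (volume.restrict (Ioo a b)) ∧ ∃ g, HasWeakDeriv a b f g ∧ MemSobolev m p a b g

/-- The `W^{2,2}(0, 1)`-norm. It is used only for functions in `W^{2,2}(0, 1)`, given by their `C¹`
representative; then `deriv f` is absolutely continuous, hence differentiable almost everywhere, and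
`deriv (deriv f)` is, almost everywhere, the second weak derivative. -/
def w22Norm {E : Type*} [NormedAddCommGroup E] [NormedSpace ℝ E] (f : ℝ → E) : ℝ≥0∞ :=
  eLpNorm f 2 (volume.restrict (Ioo 0 1)) + eLpNorm (deriv f) 2 (volume.restrict (Ioo 0 1)) +
    eLpNorm (deriv (deriv f)) 2 (volume.restrict (Ioo 0 1))

/-! ### Immersed planar curves -/

/-- The Euclidean plane. The coordinates `γ¹, γ²` of a curve `γ` are `γ x 0` and `γ x 1`. -/
abbrev Plane : Type := EuclideanSpace ℝ (Fin 2)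

/-- Immersed `W^{2,2}`-curves on `[0, 1]`. As usual, a `W^{2,2}` function is given by its `C¹`
representative on `[0, 1]`; the values of `γ` outside `[0, 1]` play no role. -/
structure IsImmersedW22 (γ : ℝ → Plane) : Prop where
  contDiffOn : ContDiffOn ℝ 1 γ (Icc 0 1)
  memSobolev : MemSobolev 2 2 0 1 γ
  deriv_ne_zero : ∀ x ∈ Icc (0 : ℝ) 1, derivWithin γ (Icc 0 1) x ≠ 0

/-- The derivative `∂_s f = f' / |γ'|` with respect to the arclength of `γ`. -/
def arcDeriv (γ f : ℝ → Plane) (x : ℝ) : Plane := ‖deriv γ x‖⁻¹ • deriv f x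

/-- The curvature vector `κ = ∂_s² γ` (defined almost everywhere for a `W^{2,2}` curve). -/
def curvatureVector (γ : ℝ → Plane) : ℝ → Plane := arcDeriv γ (arcDeriv γ γ)

/-- Counterclockwise rotation by `π / 2`. -/
def rot (v : Plane) : Plane := !₂[-v 1, v 0]

/-- The signed curvature `k = ⟨κ, n⟩`, where `n` is the unit tangent `∂_s γ` rotated by `π / 2`. -/
def signedCurvature (γ : ℝ → Plane) (x : ℝ) : ℝ :=
  inner ℝ (curvatureVector γ x) (rot (arcDeriv γ γ x))

/-- The length of `γ` between the parameters `0` and `x`. -/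
def arclength (γ : ℝ → Plane) (x : ℝ) : ℝ := ∫ t in (0 : ℝ)..x, ‖deriv γ t‖

/-- The length `L[γ]` of a curve `γ` on `[0, 1]`. -/
def curveLength (γ : ℝ → Plane) : ℝ := arclength γ 1

/-- The bending energy `B[γ] = ∫_γ |κ|² ds`. -/
def bendingEnergy (γ : ℝ → Plane) : ℝ :=
  ∫ x in (0 : ℝ)..1, ‖curvatureVector γ x‖ ^ 2 * ‖deriv γ x‖

/-- The length-penalized bending energy `B[γ] + lam L[γ]`. -/
def energy (lam : ℝ) (γ : ℝ → Plane) : ℝ := bendingEnergy γ + lam * curveLength γ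

/-- The arclength parametrization `γ ∘ s⁻¹` of `γ` on `[0, L[γ]]`, where `s⁻¹` is the inverse of the
strictly increasing bijection `s = arclength γ` from `[0, 1]` onto `[0, L[γ]]`. -/
def arclengthParam (γ : ℝ → Plane) : ℝ → Plane :=
  fun s => γ (Function.invFunOn (arclength γ) (Icc 0 1) s)

/-! ### The obstacle problem -/

/-- The standing assumptions on the obstacle function. -/
structure IsObstacle (ψ : ℝ → ℝ) : Prop where
  uniformContinuous : UniformContinuous ψ
  neg_left : ∀ x, x ≤ 0 → ψ x < 0
  neg_right : ∀ x, 1 ≤ x → ψ x < 0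
  pos_somewhere : ∃ x ∈ Icc (0 : ℝ) 1, 0 < ψ x

/-- The admissible set `A`: immersed `W^{2,2}`-curves from `(0, 0)` to `(1, 0)` above the obstacle. -/
def admissible (ψ : ℝ → ℝ) : Set (ℝ → Plane) :=
  {γ | IsImmersedW22 γ ∧ γ 0 = !₂[0, 0] ∧ γ 1 = !₂[1, 0] ∧
    ∀ x ∈ Icc (0 : ℝ) 1, ψ (γ x 0) ≤ γ x 1}

/-- `γ` is a local minimizer of the energy in the admissible set, with respect to the
`W^{2,2}(0, 1)`-topology. -/
def IsLocalMinimizer (lam : ℝ) (ψ : ℝ → ℝ) (γ : ℝ → Plane) : Prop :=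
  γ ∈ admissible ψ ∧ ∃ ε : ℝ≥0∞, 0 < ε ∧
    ∀ η ∈ admissible ψ, w22Norm (η - γ) < ε → energy lam γ ≤ energy lam η

end Elastica

end

open Elastica

noncomputable section

open Filter Topology

namespace Elastica

/-! ### Absolutely continuous functions -/

/-! The curve is varied only in fixed directions of the plane. Let s be arclength, T the unit
tangent, κ the curvature vector, L the length. For w in the plane and a test function φ on (0, L),
the curve γ + t φ(s) w is again an immersed W^{2,2} curve with the same endpoints for small t > 0,
and its energy is at most E(γ) + t I + O(t²), where I = ∫ (2 φ'' ⟨κ, w⟩ + φ' g_w) ds and g_w = (λ -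
3|κ|²) ⟨T, w⟩ (`energy_perturb_le`). An upper bound suffices, because minimality supplies the
opposite inequality.

If φ ≥ 0 and w lies in the cone w² ≥ K |w¹|, with K a Lipschitz constant of ψ, the varied curve
stays above the obstacle, so I ≥ 0. Hence 2⟨κ, w⟩ minus a primitive of g_w is convex in the sense of
distributions. Near the endpoints the curve is strictly above the obstacle, so φ may have either
sign there and the same function is affine near 0 and L. A convex function that is affine near both
ends has all its slopes between the two end slopes, so it is Lipschitz on the whole interval
(`exists_lipschitzWith_ae_eq`).

A bootstrap follows (`exists_lipschitzWith_of_inequality`). Since κ is square integrable, g_w is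
integrable and its primitive is bounded, so ⟨κ, w⟩ is bounded. The cone contains a basis of the
plane, hence κ is bounded. Then g_w is bounded, its primitive is Lipschitz, and so is κ. Integrating
κ twice in arclength recovers the tangent and the curve, which gives both regularity claims. -/

theorem absolutelyContinuousOnInterval_of_dist_le {X Y : Type*} [PseudoMetricSpace X]
    [PseudoMetricSpace Y] {f : ℝ → X} {g : ℝ → Y} {a b K : ℝ}
    (hg : AbsolutelyContinuousOnInterval g a b)
    (h : ∀ x ∈ uIcc a b, ∀ y ∈ uIcc a b, dist (f x) (f y) ≤ K * dist (g x) (g y)) :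
    AbsolutelyContinuousOnInterval f a b := by
  have hK : Tendsto (fun E : ℕ × (ℕ → ℝ × ℝ) =>
      K * ∑ i ∈ Finset.range E.1, dist (g (E.2 i).1) (g (E.2 i).2))
      (AbsolutelyContinuousOnInterval.totalLengthFilter ⊓
        𝓟 (AbsolutelyContinuousOnInterval.disjWithin a b)) (𝓝 0) := by
    have := Tendsto.const_mul K hg
    simpa using this
  refine squeeze_zero' (Eventually.of_forall fun E => Finset.sum_nonneg fun _ _ => dist_nonneg)
    ?_ hK
  have : ∀ᶠ E in AbsolutelyContinuousOnInterval.totalLengthFilter ⊓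
      𝓟 (AbsolutelyContinuousOnInterval.disjWithin a b),
      E ∈ AbsolutelyContinuousOnInterval.disjWithin a b :=
    Filter.mem_inf_of_right (mem_principal_self _)
  filter_upwards [this] with E hE
  rw [Finset.mul_sum]
  exact Finset.sum_le_sum fun i hi => h _ (hE.1 i hi).1 _ (hE.1 i hi).2

theorem absolutelyContinuousOnInterval_const {X : Type*} [PseudoMetricSpace X] (c : X) (a b : ℝ) :
    AbsolutelyContinuousOnInterval (fun _ => c) a b :=
  (LipschitzWith.const c).lipschitzOnWith.absolutelyContinuousOnInterval

/-- An absolutely continuous function is the integral of its almost everywhere derivative. -/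
theorem _root_.AbsolutelyContinuousOnInterval.integrable_and_integral_eq {f g : ℝ → ℝ} {a b : ℝ}
    (hab : a ≤ b) (hf : AbsolutelyContinuousOnInterval f a b)
    (hg : ∀ᵐ x, x ∈ Ioo a b → HasDerivAt f (g x) x) :
    IntervalIntegrable g volume a b ∧ ∫ x in a..b, g x = f b - f a := by
  have hae : ∀ᵐ x, x ∈ uIoc a b → deriv f x = g x := by
    have hb : ∀ᵐ x : ℝ, x ≠ b := by simp [ae_iff, measure_singleton]
    filter_upwards [hg, hb] with x hx hxb hxm
    rw [uIoc_of_le hab] at hxm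
    exact (hx ⟨hxm.1, lt_of_le_of_ne hxm.2 hxb⟩).deriv
  constructor
  · refine hf.intervalIntegrable_deriv.congr_ae ?_
    rw [EventuallyEq, ae_restrict_iff' measurableSet_uIoc]
    exact hae
  · rw [← hf.integral_deriv_eq_sub]
    refine intervalIntegral.integral_congr_ae ?_
    filter_upwards [hae] with x hx hxm
    exact (hx hxm).symm

theorem hasDerivAt_plane_apply {f : ℝ → Plane} {f' : Plane} {x : ℝ} (h : HasDerivAt f f' x)
    (i : Fin 2) : HasDerivAt (fun y => f y i) (f' i) x :=
  (EuclideanSpace.proj (𝕜 := ℝ) i).hasFDerivAt.comp_hasDerivAt x h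

theorem absolutelyContinuousOnInterval_apply {f : ℝ → Plane} {a b : ℝ}
    (h : AbsolutelyContinuousOnInterval f a b) (i : Fin 2) :
    AbsolutelyContinuousOnInterval (fun x => f x i) a b := by
  refine absolutelyContinuousOnInterval_of_dist_le (K := 1) h fun x _ y _ => ?_
  rw [one_mul, dist_eq_norm, dist_eq_norm]
  exact PiLp.norm_apply_le (f x - f y) i

theorem plane_eq (v : Plane) :
    v = v 0 • EuclideanSpace.single 0 (1 : ℝ) + v 1 • EuclideanSpace.single 1 (1 : ℝ) := by
  ext i
  fin_cases i <;> simp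

theorem absolutelyContinuousOnInterval_of_apply {f : ℝ → Plane} {a b : ℝ}
    (h : ∀ i, AbsolutelyContinuousOnInterval (fun x => f x i) a b) :
    AbsolutelyContinuousOnInterval f a b := by
  have := ((h 0).fun_smul (absolutelyContinuousOnInterval_const
    (EuclideanSpace.single 0 (1 : ℝ) : Plane) a b)).fun_add
    ((h 1).fun_smul (absolutelyContinuousOnInterval_const
      (EuclideanSpace.single 1 (1 : ℝ) : Plane) a b))
  simpa only [← plane_eq] using this

theorem integrable_plane_iff {μ : Measure ℝ} {f : ℝ → Plane} :
    Integrable f μ ↔ ∀ i, Integrable (fun x => f x i) μ := by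
  constructor
  · intro h i
    exact (EuclideanSpace.proj (𝕜 := ℝ) i).integrable_comp h
  · intro h
    have := ((h 0).smul_const (EuclideanSpace.single 0 (1 : ℝ) : Plane)).add
      ((h 1).smul_const (EuclideanSpace.single 1 (1 : ℝ) : Plane))
    refine this.congr (Eventually.of_forall fun x => ?_)
    exact (plane_eq (f x)).symm

theorem integral_plane_apply {μ : Measure ℝ} {f : ℝ → Plane} (hf : Integrable f μ) (i : Fin 2) :
    (∫ x, f x ∂μ) i = ∫ x, f x i ∂μ :=
  ((EuclideanSpace.proj (𝕜 := ℝ) i).integral_comp_comm hf).symm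

theorem intervalIntegrable_plane_iff {f : ℝ → Plane} {a b : ℝ} (hab : a ≤ b) :
    IntervalIntegrable f volume a b ↔ ∀ i, IntervalIntegrable (fun x => f x i) volume a b := by
  simp only [intervalIntegrable_iff_integrableOn_Ioc_of_le hab]
  exact integrable_plane_iff

theorem intervalIntegral_plane_apply {f : ℝ → Plane} {a b : ℝ}
    (hf : IntervalIntegrable f volume a b) (i : Fin 2) :
    (∫ x in a..b, f x) i = ∫ x in a..b, f x i :=
  ((EuclideanSpace.proj (𝕜 := ℝ) i).intervalIntegral_comp_comm hf).symm

/-- An absolutely continuous plane curve is the integral of its almost everywhere derivative. -/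
theorem integrable_and_integral_eq_plane {f g : ℝ → Plane} {a b : ℝ}
    (hab : a ≤ b) (hf : AbsolutelyContinuousOnInterval f a b)
    (hg : ∀ᵐ x, x ∈ Ioo a b → HasDerivAt f (g x) x) :
    IntervalIntegrable g volume a b ∧ ∫ x in a..b, g x = f b - f a := by
  have h (i : Fin 2) := (absolutelyContinuousOnInterval_apply hf i).integrable_and_integral_eq
    (g := fun x => g x i) hab (by
      filter_upwards [hg] with x hx hxm
      exact hasDerivAt_plane_apply (hx hxm) i)
  have hint := (intervalIntegrable_plane_iff hab).2 fun i => (h i).1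
  refine ⟨hint, ?_⟩
  ext i
  rw [intervalIntegral_plane_apply hint]
  exact (h i).2

theorem absolutelyContinuousOnInterval_integral_plane {q : ℝ → Plane} {a b : ℝ} (hab : a ≤ b)
    (hq : IntervalIntegrable q volume a b) :
    AbsolutelyContinuousOnInterval (fun x => ∫ t in a..x, q t) a b := by
  refine absolutelyContinuousOnInterval_of_apply fun i => ?_
  have h := ((intervalIntegrable_plane_iff hab).1 hq i).absolutelyContinuousOnInterval_intervalIntegral
    (c := a) left_mem_uIcc
  refine absolutelyContinuousOnInterval_of_dist_le (K := 1) h fun x hx y hy => ?_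
  have hsub : ∀ z ∈ uIcc a b, (∫ t in a..z, q t) i = ∫ t in a..z, q t i := fun z hz =>
    intervalIntegral_plane_apply (hq.mono_set (uIcc_subset_uIcc_left hz)) i
  rw [hsub x hx, hsub y hy, one_mul]

/-! ### Test functions and weak derivatives -/

/-- Test functions on the interval `(a, b)`. -/
structure IsTestFunction (a b : ℝ) (φ : ℝ → ℝ) : Prop where
  contDiff : ContDiff ℝ (⊤ : ℕ∞) φ
  hasCompactSupport : HasCompactSupport φ
  tsupport_subset : tsupport φ ⊆ Ioo a b

theorem isTestFunction_of_eq_zero {a b c d : ℝ} {φ : ℝ → ℝ} (hφ : ContDiff ℝ (⊤ : ℕ∞) φ)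
    (hac : a < c) (hdb : d < b) (h : ∀ x, x ∉ Icc c d → φ x = 0) : IsTestFunction a b φ := by
  have hsub : tsupport φ ⊆ Icc c d := by
    refine closure_minimal (fun x hx => ?_) isClosed_Icc
    by_contra hxc
    exact hx (h x hxc)
  exact ⟨hφ, HasCompactSupport.of_support_subset_isCompact isCompact_Icc
    (subset_closure.trans hsub), hsub.trans (Icc_subset_Ioo hac hdb)⟩

namespace IsTestFunction

variable {a b : ℝ} {φ : ℝ → ℝ}

theorem eq_zero (h : IsTestFunction a b φ) {x : ℝ} (hx : x ∉ Ioo a b) : φ x = 0 :=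
  image_eq_zero_of_notMem_tsupport fun hx' => hx (h.tsupport_subset hx')

theorem deriv (h : IsTestFunction a b φ) : IsTestFunction a b (deriv φ) :=
  ⟨(contDiff_infty_iff_deriv.1 h.contDiff).2, h.hasCompactSupport.deriv,
    (tsupport_deriv_subset (𝕜 := ℝ)).trans h.tsupport_subset⟩

theorem neg (h : IsTestFunction a b φ) : IsTestFunction a b (fun x => -φ x) :=
  ⟨h.contDiff.neg, h.hasCompactSupport.neg, by
    have : tsupport (fun x => -φ x) = tsupport φ := by
      simp only [tsupport]
      congr 1
      ext x
      simp
    rw [this]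
    exact h.tsupport_subset⟩

theorem mono {c d : ℝ} (h : IsTestFunction a b φ) (hc : c ≤ a) (hd : b ≤ d) :
    IsTestFunction c d φ :=
  ⟨h.contDiff, h.hasCompactSupport, h.tsupport_subset.trans (Ioo_subset_Ioo hc hd)⟩

theorem hasDerivAt (h : IsTestFunction a b φ) (x : ℝ) : HasDerivAt φ (_root_.deriv φ x) x :=
  ((h.contDiff.differentiable (by simp)) x).hasDerivAt

theorem continuous (h : IsTestFunction a b φ) : Continuous φ := h.contDiff.continuous

theorem exists_bound (h : IsTestFunction a b φ) : ∃ C, 0 ≤ C ∧ ∀ x, |φ x| ≤ C := by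
  obtain ⟨C, hC⟩ := h.hasCompactSupport.exists_bound_of_continuous h.continuous
  exact ⟨C, (norm_nonneg _).trans (hC 0), hC⟩

theorem absolutelyContinuousOnInterval (h : IsTestFunction a b φ) (c d : ℝ) :
    AbsolutelyContinuousOnInterval φ c d :=
  ContDiffOn.absolutelyContinuousOnInterval (h.contDiff.of_le (by simp)).contDiffOn

theorem integrable_mul (h : IsTestFunction a b φ) {μ : Measure ℝ} {f : ℝ → ℝ}
    (hf : Integrable f μ) : Integrable (fun x => φ x * f x) μ := by
  obtain ⟨C, _, hC⟩ := h.exists_bound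
  exact hf.bdd_mul h.continuous.aestronglyMeasurable (Eventually.of_forall hC)

end IsTestFunction

/-- Integration by parts of an absolutely continuous function against a test function. -/
theorem integral_deriv_mul_eq_neg {f g φ : ℝ → ℝ} {a b : ℝ} (hab : a ≤ b)
    (hf : AbsolutelyContinuousOnInterval f a b)
    (hg : ∀ᵐ x, x ∈ Ioo a b → HasDerivAt f (g x) x) (hφ : IsTestFunction a b φ) :
    ∫ x in Ioo a b, deriv φ x * f x = -∫ x in Ioo a b, φ x * g x := by
  have h := hf.integral_mul_deriv_eq_deriv_mul (hφ.absolutelyContinuousOnInterval a b)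
  rw [hφ.eq_zero (x := a) (by simp), hφ.eq_zero (x := b) (by simp)] at h
  simp only [intervalIntegral.integral_of_le hab, integral_Ioc_eq_integral_Ioo, mul_zero, sub_zero,
    zero_sub] at h
  simp_rw [mul_comm (deriv φ _)]
  rw [h]
  congr 1
  refine integral_congr_ae ?_
  rw [EventuallyEq, ae_restrict_iff' measurableSet_Ioo]
  filter_upwards [hg] with x hx hxm
  rw [(hx hxm).deriv, mul_comm]

theorem hasWeakDeriv_of_absolutelyContinuousOnInterval {f g : ℝ → ℝ} {a b : ℝ} (hab : a ≤ b)
    (hf : AbsolutelyContinuousOnInterval f a b)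
    (hg : ∀ᵐ x, x ∈ Ioo a b → HasDerivAt f (g x) x) : HasWeakDeriv a b f g := by
  have hfi : IntegrableOn f (Ioo a b) :=
    ((hf.continuousOn.integrableOn_compact isCompact_uIcc).mono_set
      (Ioo_subset_Icc_self.trans Icc_subset_uIcc))
  have hgi : IntegrableOn g (Ioo a b) :=
    ((intervalIntegrable_iff_integrableOn_Ioc_of_le hab).1
      (hf.integrable_and_integral_eq hab hg).1).mono_set Ioo_subset_Ioc_self
  refine ⟨hfi.locallyIntegrableOn, hgi.locallyIntegrableOn, fun φ h1 h2 h3 => ?_⟩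
  simpa only [smul_eq_mul] using integral_deriv_mul_eq_neg hab hf hg ⟨h1, h2, h3⟩

theorem integral_smul_plane_apply {φ : ℝ → ℝ} {f : ℝ → Plane} {a b : ℝ}
    (hφ : IsTestFunction a b φ) (hf : IntegrableOn f (Ioo a b)) (i : Fin 2) :
    (∫ x in Ioo a b, φ x • f x) i = ∫ x in Ioo a b, φ x * f x i := by
  rw [integral_plane_apply]
  · rfl
  · rw [integrable_plane_iff]
    exact fun j => hφ.integrable_mul (integrable_plane_iff.1 hf j)

theorem hasWeakDeriv_plane_of_absolutelyContinuousOnInterval {f g : ℝ → Plane} {a b : ℝ}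
    (hab : a ≤ b) (hf : AbsolutelyContinuousOnInterval f a b)
    (hg : ∀ᵐ x, x ∈ Ioo a b → HasDerivAt f (g x) x) : HasWeakDeriv a b f g := by
  have hfi : IntegrableOn f (Ioo a b) :=
    ((hf.continuousOn.integrableOn_compact isCompact_uIcc).mono_set
      (Ioo_subset_Icc_self.trans Icc_subset_uIcc))
  have hgi : IntegrableOn g (Ioo a b) :=
    ((intervalIntegrable_iff_integrableOn_Ioc_of_le hab).1
      (integrable_and_integral_eq_plane hab hf hg).1).mono_set Ioo_subset_Ioc_self
  refine ⟨hfi.locallyIntegrableOn, hgi.locallyIntegrableOn, fun φ h1 h2 h3 => ?_⟩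
  have hφ : IsTestFunction a b φ := ⟨h1, h2, h3⟩
  ext i
  rw [PiLp.neg_apply, integral_smul_plane_apply hφ.deriv hfi, integral_smul_plane_apply hφ hgi]
  exact integral_deriv_mul_eq_neg hab (absolutelyContinuousOnInterval_apply hf i) (by
    filter_upwards [hg] with x hx hxm
    exact hasDerivAt_plane_apply (hx hxm) i) hφ

theorem HasWeakDeriv.apply {f g : ℝ → Plane} {a b : ℝ} (hf : IntegrableOn f (Ioo a b))
    (hg : IntegrableOn g (Ioo a b)) (h : HasWeakDeriv a b f g) {φ : ℝ → ℝ}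
    (hφ : IsTestFunction a b φ) (i : Fin 2) :
    ∫ x in Ioo a b, deriv φ x * f x i = -∫ x in Ioo a b, φ x * g x i := by
  rw [← integral_smul_plane_apply hφ.deriv hf, ← integral_smul_plane_apply hφ hg,
    h.2.2 φ hφ.contDiff hφ.hasCompactSupport hφ.tsupport_subset, PiLp.neg_apply]

/-! ### Mollified ramps -/

/-- A smooth approximation of the Dirac mass, supported in `[-1/(n+1), 1/(n+1)]`. -/
def moll (n : ℕ) : ℝ → ℝ :=
  (⟨1 / (2 * ((n : ℝ) + 1)), 1 / ((n : ℝ) + 1), by positivity, by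
    apply one_div_lt_one_div_of_lt <;> [positivity; linarith [(n.cast_nonneg : (0 : ℝ) ≤ n)]]⟩ :
    ContDiffBump (0 : ℝ)).normed volume

/-- A smooth approximation of the Heaviside function. -/
def heav (n : ℕ) (t : ℝ) : ℝ := ∫ x in (-1 : ℝ)..t, moll n x

/-- A smooth convex approximation of the positive part. -/
def ramp (n : ℕ) (t : ℝ) : ℝ := ∫ x in (-1 : ℝ)..t, heav n x

theorem contDiff_moll (n : ℕ) : ContDiff ℝ (⊤ : ℕ∞) (moll n) := ContDiffBump.contDiff_normed _

theorem moll_nonneg (n : ℕ) (x : ℝ) : 0 ≤ moll n x := ContDiffBump.nonneg_normed _ _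

theorem moll_neg (n : ℕ) (x : ℝ) : moll n (-x) = moll n x := ContDiffBump.normed_neg _ _

theorem moll_eq_zero {n : ℕ} {x : ℝ} (hx : 1 / ((n : ℝ) + 1) ≤ |x|) : moll n x = 0 := by
  have : x ∉ Function.support (moll n) := by
    rw [moll, ContDiffBump.support_normed_eq]
    simpa [Real.norm_eq_abs] using hx
  simpa using this

theorem integral_moll (n : ℕ) : ∫ x, moll n x = 1 := ContDiffBump.integral_normed _

theorem hasDerivAt_heav (n : ℕ) (t : ℝ) : HasDerivAt (heav n) (moll n t) t :=
  (contDiff_moll n).continuous.integral_hasStrictDerivAt _ _ |>.hasDerivAt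

theorem deriv_heav (n : ℕ) : deriv (heav n) = moll n := funext fun t => (hasDerivAt_heav n t).deriv

theorem contDiff_heav (n : ℕ) : ContDiff ℝ (⊤ : ℕ∞) (heav n) :=
  contDiff_infty_iff_deriv.2 ⟨fun t => (hasDerivAt_heav n t).differentiableAt, by
    rw [deriv_heav]; exact contDiff_moll n⟩

theorem hasDerivAt_ramp (n : ℕ) (t : ℝ) : HasDerivAt (ramp n) (heav n t) t :=
  (contDiff_heav n).continuous.integral_hasStrictDerivAt _ _ |>.hasDerivAt

theorem deriv_ramp (n : ℕ) : deriv (ramp n) = heav n := funext fun t => (hasDerivAt_ramp n t).deriv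

theorem contDiff_ramp (n : ℕ) : ContDiff ℝ (⊤ : ℕ∞) (ramp n) :=
  contDiff_infty_iff_deriv.2 ⟨fun t => (hasDerivAt_ramp n t).differentiableAt, by
    rw [deriv_ramp]; exact contDiff_heav n⟩

theorem one_div_succ_le_one (n : ℕ) : 1 / ((n : ℝ) + 1) ≤ 1 := by
  rw [div_le_one (by positivity)]
  linarith [(n.cast_nonneg : (0 : ℝ) ≤ n)]

/-- The lower limit -1 in `heav` and `ramp` works for every n at once because the bumps are
supported in [-1/(n+1), 1/(n+1)] ⊆ [-1, 1]. -/
theorem heav_of_le {n : ℕ} {t : ℝ} (ht : t ≤ -(1 / ((n : ℝ) + 1))) : heav n t = 0 := by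
  have h1 := one_div_succ_le_one n
  have h0 : 0 < 1 / ((n : ℝ) + 1) := by positivity
  rw [heav]
  refine intervalIntegral.integral_zero_ae (Eventually.of_forall fun x hx => moll_eq_zero ?_)
  rw [mem_uIoc] at hx
  rw [abs_of_neg] <;> rcases hx with hx | hx <;> linarith [hx.1, hx.2]

theorem heav_of_ge {n : ℕ} {t : ℝ} (ht : 1 / ((n : ℝ) + 1) ≤ t) : heav n t = 1 := by
  have h1 := one_div_succ_le_one n
  have h0 : 0 < 1 / ((n : ℝ) + 1) := by positivity
  rw [heav]
  refine (intervalIntegral.integral_eq_integral_of_support_subset fun x hx => ?_).trans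
    (integral_moll n)
  have : ¬ 1 / ((n : ℝ) + 1) ≤ |x| := fun h => hx (moll_eq_zero h)
  rw [not_le, abs_lt] at this
  constructor <;> linarith [this.1, this.2]

theorem ramp_of_le {n : ℕ} {t : ℝ} (ht : t ≤ -(1 / ((n : ℝ) + 1))) : ramp n t = 0 := by
  have h1 := one_div_succ_le_one n
  have h0 : 0 < 1 / ((n : ℝ) + 1) := by positivity
  rw [ramp]
  refine intervalIntegral.integral_zero_ae (Eventually.of_forall fun x hx => heav_of_le ?_)
  rw [mem_uIoc] at hx
  rcases hx with hx | hx <;> linarith [hx.1, hx.2]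

/-- Past the mollification scale the ramp is exactly affine with slope 1. Its offset, expressed
through `ramp n 1`, is never computed: it cancels in second differences. -/
theorem ramp_of_ge {n : ℕ} {t : ℝ} (ht : 1 / ((n : ℝ) + 1) ≤ t) : ramp n t = ramp n 1 + (t - 1) := by
  have h1 := one_div_succ_le_one n
  have hi : ∀ c d, IntervalIntegrable (heav n) volume c d := fun c d =>
    (contDiff_heav n).continuous.intervalIntegrable c d
  rw [ramp, ← intervalIntegral.integral_add_adjacent_intervals (hi (-1) 1) (hi 1 t), ← ramp]
  congr 1
  have : ∫ x in (1 : ℝ)..t, heav n x = ∫ x in (1 : ℝ)..t, (1 : ℝ) := by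
    refine intervalIntegral.integral_congr fun x hx => heav_of_ge ?_
    rw [mem_uIcc] at hx
    rcases hx with hx | hx <;> linarith [hx.1, hx.2]
  rw [this]
  simp

theorem convexOn_ramp (n : ℕ) : ConvexOn ℝ univ (ramp n) := by
  refine MonotoneOn.convexOn_of_deriv convex_univ (contDiff_ramp n).continuous.continuousOn
    ((contDiff_ramp n).differentiable (by simp)).differentiableOn ?_
  rw [deriv_ramp]
  refine Monotone.monotoneOn (monotone_of_deriv_nonneg
    (fun t => (hasDerivAt_heav n t).differentiableAt) fun t => ?_) _
  rw [deriv_heav]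
  exact moll_nonneg n t

/-- Lebesgue differentiation. The factor 2 bounds the ratio of outer to inner radius of the bumps,
and their evenness turns the convolution kernel x - t into t - x. -/
theorem ae_tendsto_integral_moll {f : ℝ → ℝ} (hf : Integrable f) :
    ∀ᵐ x, Tendsto (fun n => ∫ t, moll n (t - x) * f t) atTop (𝓝 (f x)) := by
  have h := ContDiffBump.ae_convolution_tendsto_right_of_locallyIntegrable (μ := volume) (K := 2)
    (φ := fun n : ℕ => (⟨1 / (2 * ((n : ℝ) + 1)), 1 / ((n : ℝ) + 1), by positivity, by
      apply one_div_lt_one_div_of_lt <;> [positivity; linarith [(n.cast_nonneg : (0 : ℝ) ≤ n)]]⟩ :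
      ContDiffBump (0 : ℝ))) tendsto_one_div_add_atTop_nhds_zero_nat
    (Eventually.of_forall fun n => by
      change 1 / ((n : ℝ) + 1) ≤ 2 * (1 / (2 * ((n : ℝ) + 1)))
      apply le_of_eq
      field_simp) hf.locallyIntegrable
  filter_upwards [h] with x hx
  refine hx.congr fun n => ?_
  rw [convolution_eq_swap]
  refine integral_congr_ae (Eventually.of_forall fun t => ?_)
  change moll n (x - t) * f t = moll n (t - x) * f t
  rw [← moll_neg n (x - t), neg_sub]

/-! ### Distributional inequalities on an interval -/

theorem ae_tendsto_setIntegral_moll {f : ℝ → ℝ} {a b : ℝ} (hf : IntegrableOn f (Ioo a b)) :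
    ∀ᵐ x, x ∈ Ioo a b →
      Tendsto (fun n => ∫ t in Ioo a b, moll n (t - x) * f t) atTop (𝓝 (f x)) := by
  filter_upwards [ae_tendsto_integral_moll (hf.integrable_indicator measurableSet_Ioo)]
    with x hx hxm
  rw [indicator_of_mem hxm] at hx
  refine hx.congr fun n => ?_
  rw [← integral_indicator measurableSet_Ioo]
  congr 1
  ext t
  by_cases ht : t ∈ Ioo a b <;> simp [ht]

theorem contDiff_comp_sub {g : ℝ → ℝ} (hg : ContDiff ℝ (⊤ : ℕ∞) g) (x : ℝ) :
    ContDiff ℝ (⊤ : ℕ∞) (fun t => g (t - x)) :=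
  hg.comp (contDiff_id.sub contDiff_const)

theorem integrableOn_moll_mul {f : ℝ → ℝ} {a b : ℝ} (hf : IntegrableOn f (Ioo a b)) (n : ℕ)
    (x : ℝ) : IntegrableOn (fun t => moll n (t - x) * f t) (Ioo a b) := by
  have hm : IsTestFunction (x - 2) (x + 2) (fun t => moll n (t - x)) := by
    refine isTestFunction_of_eq_zero (c := x - 1) (d := x + 1) (contDiff_comp_sub (contDiff_moll n) x)
      (by linarith) (by linarith) fun t ht => moll_eq_zero ((one_div_succ_le_one n).trans ?_)
    by_contra h
    rw [not_le, abs_lt] at h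
    exact ht ⟨by linarith [h.1], by linarith [h.2]⟩
  exact hm.integrable_mul hf

theorem eventually_one_div_succ_lt {r : ℝ} (hr : 0 < r) : ∀ᶠ n : ℕ in atTop, 1 / ((n : ℝ) + 1) < r :=
  tendsto_one_div_add_atTop_nhds_zero_nat.eventually (gt_mem_nhds hr)

/-- A function whose weak derivative vanishes is constant almost everywhere. -/
theorem ae_eq_const_of_integral_deriv_mul_eq_zero {f : ℝ → ℝ} {a b : ℝ} (hab : a < b)
    (hf : IntegrableOn f (Ioo a b))
    (h : ∀ φ, IsTestFunction a b φ → ∫ x in Ioo a b, deriv φ x * f x = 0) :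
    ∃ c, ∀ᵐ x, x ∈ Ioo a b → f x = c := by
  have hae := ae_tendsto_setIntegral_moll hf
  obtain ⟨x, hx, hxab⟩ := (Measure.dense_of_ae hae).exists_between hab
  refine ⟨f x, ?_⟩
  filter_upwards [hae] with y hy hyab
  have hlim := (hx hxab).sub (hy hyab)
  refine (sub_eq_zero.1 (tendsto_nhds_unique hlim (tendsto_const_nhds.congr' ?_))).symm
  filter_upwards [eventually_one_div_succ_lt (r := min x y - a) (by simp [hxab.1, hyab.1]),
    eventually_one_div_succ_lt (r := b - max x y) (by simp [hxab.2, hyab.2])] with n hn1 hn2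
  -- A difference of two smoothed Heaviside functions has compact support, and its derivative is a
  -- difference of two approximate Dirac masses. Testing with it compares f x and f y in the limit.
  have hφ : IsTestFunction a b (fun t => heav n (t - x) - heav n (t - y)) := by
    refine isTestFunction_of_eq_zero (c := min x y - 1 / ((n : ℝ) + 1))
      (d := max x y + 1 / ((n : ℝ) + 1))
      ((contDiff_comp_sub (contDiff_heav n) x).sub (contDiff_comp_sub (contDiff_heav n) y))
      (by linarith) (by linarith) fun t ht => ?_
    rw [mem_Icc, not_and_or, not_le, not_le] at ht
    rcases ht with ht | ht
    · rw [heav_of_le (by linarith [min_le_left x y]), heav_of_le (by linarith [min_le_right x y]),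
        sub_self]
    · rw [heav_of_ge (by linarith [le_max_left x y]), heav_of_ge (by linarith [le_max_right x y]),
        sub_self]
  have hd : deriv (fun t => heav n (t - x) - heav n (t - y)) =
      fun t => moll n (t - x) - moll n (t - y) := by
    ext t
    exact (((hasDerivAt_heav n (t - x)).comp_sub_const t x).sub
      ((hasDerivAt_heav n (t - y)).comp_sub_const t y)).deriv
  have := h _ hφ
  rw [hd] at this
  rw [← integral_sub (integrableOn_moll_mul hf n x) (integrableOn_moll_mul hf n y), ← this]
  simp only [sub_mul]

/-- A function with an integrable weak derivative is a primitive of it. -/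
theorem ae_eq_const_add_integral {f g : ℝ → ℝ} {a b : ℝ} (hab : a < b)
    (hf : IntegrableOn f (Ioo a b)) (hg : IntegrableOn g (Ioo a b))
    (h : ∀ φ, IsTestFunction a b φ →
      ∫ x in Ioo a b, deriv φ x * f x = -∫ x in Ioo a b, φ x * g x) :
    ∃ c, ∀ᵐ x, x ∈ Ioo a b → f x = c + ∫ t in a..x, g t := by
  have hgi : IntervalIntegrable g volume a b :=
    (intervalIntegrable_iff_integrableOn_Ioo_of_le hab.le).2 hg
  have hac := hgi.absolutelyContinuousOnInterval_intervalIntegral (c := a) left_mem_uIcc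
  have hder : ∀ᵐ x, x ∈ Ioo a b → HasDerivAt (fun x => ∫ t in a..x, g t) (g x) x := by
    filter_upwards [hgi.ae_hasDerivAt_integral] with x hx hxm
    exact hx (Icc_subset_uIcc (Ioo_subset_Icc_self hxm)) a left_mem_uIcc
  have hGi : IntegrableOn (fun x => ∫ t in a..x, g t) (Ioo a b) :=
    (hac.continuousOn.integrableOn_compact isCompact_uIcc).mono_set
      (Ioo_subset_Icc_self.trans Icc_subset_uIcc)
  obtain ⟨c, hc⟩ := ae_eq_const_of_integral_deriv_mul_eq_zero hab (hf.sub hGi) fun φ hφ => by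
    have h1 := h φ hφ
    have h2 := integral_deriv_mul_eq_neg hab.le hac hder hφ
    simp only [Pi.sub_apply, mul_sub]
    rw [integral_sub (hφ.deriv.integrable_mul hf) (hφ.deriv.integrable_mul hGi), h1, h2, sub_self]
  refine ⟨c, ?_⟩
  filter_upwards [hc] with x hx hxm
  have := hx hxm
  simp only [Pi.sub_apply] at this
  linarith

/-- The test function is a second difference of ramps: nonnegative because the ramp is convex, zero
on the far right because the affine pieces cancel, and with second derivative the matching
combination of three approximate Dirac masses. In the limit the distributional inequality becomes
the convexity inequality at x, y, z. Positivity is tested on the subinterval (c, d) only, so that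
the lemma also applies near the endpoints. -/
theorem three_point_le {f : ℝ → ℝ} {a b c d x y z : ℝ} (hf : IntegrableOn f (Ioo a b))
    (h : ∀ φ, IsTestFunction c d φ → (∀ t, 0 ≤ φ t) →
      0 ≤ ∫ t in Ioo a b, deriv (deriv φ) t * f t)
    (hcx : c < x) (hxy : x < y) (hyz : y < z) (hzd : z < d)
    (hx : Tendsto (fun n => ∫ t in Ioo a b, moll n (t - x) * f t) atTop (𝓝 (f x)))
    (hy : Tendsto (fun n => ∫ t in Ioo a b, moll n (t - y) * f t) atTop (𝓝 (f y)))
    (hz : Tendsto (fun n => ∫ t in Ioo a b, moll n (t - z) * f t) atTop (𝓝 (f z))) :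
    (z - x) * f y ≤ (z - y) * f x + (y - x) * f z := by
  have hlim := ((hx.const_mul (z - y)).sub (hy.const_mul (z - x))).add (hz.const_mul (y - x))
  suffices 0 ≤ (z - y) * f x - (z - x) * f y + (y - x) * f z by linarith
  refine ge_of_tendsto hlim ?_
  filter_upwards [eventually_one_div_succ_lt (r := x - c) (by linarith),
    eventually_one_div_succ_lt (r := d - z) (by linarith)] with n hn1 hn2
  set e := 1 / ((n : ℝ) + 1)
  have hφ : IsTestFunction c d (fun t => (z - y) * ramp n (t - x) - (z - x) * ramp n (t - y) +
      (y - x) * ramp n (t - z)) := by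
    refine isTestFunction_of_eq_zero (c := x - e) (d := z + e)
      (((contDiff_const.mul (contDiff_comp_sub (contDiff_ramp n) x)).sub
        (contDiff_const.mul (contDiff_comp_sub (contDiff_ramp n) y))).add
        (contDiff_const.mul (contDiff_comp_sub (contDiff_ramp n) z)))
      (by linarith) (by linarith) fun t ht => ?_
    rw [mem_Icc, not_and_or, not_le, not_le] at ht
    rcases ht with ht | ht
    · rw [ramp_of_le (by linarith), ramp_of_le (by linarith), ramp_of_le (by linarith)]
      ring
    · rw [ramp_of_ge (t := t - x) (by linarith), ramp_of_ge (t := t - y) (by linarith),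
        ramp_of_ge (t := t - z) (by linarith)]
      ring
  have hd : deriv (deriv (fun t => (z - y) * ramp n (t - x) - (z - x) * ramp n (t - y) +
      (y - x) * ramp n (t - z))) = fun t => (z - y) * moll n (t - x) - (z - x) * moll n (t - y) +
      (y - x) * moll n (t - z) := by
    have : deriv (fun t => (z - y) * ramp n (t - x) - (z - x) * ramp n (t - y) +
      (y - x) * ramp n (t - z)) = fun t => (z - y) * heav n (t - x) - (z - x) * heav n (t - y) +
      (y - x) * heav n (t - z) := by
      ext t
      exact (((((hasDerivAt_ramp n (t - x)).comp_sub_const t x).const_mul _).sub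
        (((hasDerivAt_ramp n (t - y)).comp_sub_const t y).const_mul _)).add
        (((hasDerivAt_ramp n (t - z)).comp_sub_const t z).const_mul _)).deriv
    rw [this]
    ext t
    exact (((((hasDerivAt_heav n (t - x)).comp_sub_const t x).const_mul _).sub
      (((hasDerivAt_heav n (t - y)).comp_sub_const t y).const_mul _)).add
      (((hasDerivAt_heav n (t - z)).comp_sub_const t z).const_mul _)).deriv
  have hpos := h _ hφ fun t => by
    have hzx : 0 < z - x := by linarith
    have w1 : 0 ≤ (z - y) / (z - x) := div_nonneg (by linarith) hzx.le
    have w2 : 0 ≤ (y - x) / (z - x) := div_nonneg (by linarith) hzx.le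
    have w3 : (z - y) / (z - x) + (y - x) / (z - x) = 1 := by
      field_simp
      ring
    have := (convexOn_ramp n).2 (mem_univ (t - x)) (mem_univ (t - z)) w1 w2 w3
    have he : (z - y) / (z - x) * (t - x) + (y - x) / (z - x) * (t - z) = t - y := by
      field_simp
      ring
    simp only [smul_eq_mul, he] at this
    have h2 := mul_le_mul_of_nonneg_left this hzx.le
    have h3 : (z - x) * ((z - y) / (z - x) * ramp n (t - x) + (y - x) / (z - x) * ramp n (t - z)) =
      (z - y) * ramp n (t - x) + (y - x) * ramp n (t - z) := by field_simp
    linarith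
  rw [hd] at hpos
  have hi := integrableOn_moll_mul hf n
  have hs : IntegrableOn (fun t => (z - y) * (moll n (t - x) * f t) -
      (z - x) * (moll n (t - y) * f t)) (Ioo a b) := ((hi x).const_mul _).sub ((hi y).const_mul _)
  rw [← integral_const_mul, ← integral_const_mul, ← integral_const_mul,
    ← integral_sub ((hi x).const_mul _) ((hi y).const_mul _),
    ← integral_add hs ((hi z).const_mul _)]
  refine hpos.trans (le_of_eq ?_)
  congr 1
  ext t
  ring

/-- A distributionally convex function on `(a, b)` which is distributionally affine near the
endpoints is almost everywhere equal to a Lipschitz function. -/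
theorem exists_lipschitzWith_ae_eq {f : ℝ → ℝ} {a b c d : ℝ} (hac : a < c) (hcb : c < b)
    (had : a < d) (hdb : d < b) (hf : IntegrableOn f (Ioo a b))
    (h : ∀ φ, IsTestFunction a b φ → (∀ t, 0 ≤ φ t) →
      0 ≤ ∫ t in Ioo a b, deriv (deriv φ) t * f t)
    (hl : ∀ φ, IsTestFunction a c φ → ∫ t in Ioo a b, deriv (deriv φ) t * f t = 0)
    (hr : ∀ φ, IsTestFunction d b φ → ∫ t in Ioo a b, deriv (deriv φ) t * f t = 0) :
    ∃ (K : ℝ≥0) (g : ℝ → ℝ), LipschitzWith K g ∧ ∀ᵐ x, x ∈ Ioo a b → f x = g x := by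
  have hae := ae_tendsto_setIntegral_moll hf
  have hdense := Measure.dense_of_ae hae
  set S : Set ℝ := {x | x ∈ Ioo a b →
    Tendsto (fun n => ∫ t in Ioo a b, moll n (t - x) * f t) atTop (𝓝 (f x))} with hS
  have hconv : ∀ x ∈ S, ∀ y ∈ S, ∀ z ∈ S, a < x → x < y → y < z → z < b →
      (z - x) * f y ≤ (z - y) * f x + (y - x) * f z := fun x hx y hy z hz h1 h2 h3 h4 =>
    three_point_le hf h h1 h2 h3 h4 (hx ⟨h1, by linarith⟩) (hy ⟨by linarith, by linarith⟩)
      (hz ⟨by linarith, h4⟩)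
  -- Where the second derivative vanishes, the three-point inequality holds for both f and -f.
  have haff : ∀ c d : ℝ, a ≤ c → d ≤ b →
      (∀ φ, IsTestFunction c d φ → ∫ t in Ioo a b, deriv (deriv φ) t * f t = 0) →
      ∀ x ∈ S, ∀ y ∈ S, ∀ z ∈ S, c < x → x < y → y < z → z < d →
      (z - x) * f y = (z - y) * f x + (y - x) * f z := by
    intro c d hc hd hcd x hx y hy z hz h1 h2 h3 h4
    have hx' := hx ⟨by linarith, by linarith⟩
    have hy' := hy ⟨by linarith, by linarith⟩
    have hz' := hz ⟨by linarith, by linarith⟩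
    have u1 := three_point_le hf (fun φ hφ _ => (hcd φ hφ).ge) h1 h2 h3 h4 hx' hy' hz'
    have hneg : ∀ {u : ℝ}, Tendsto (fun n => ∫ t in Ioo a b, moll n (t - u) * f t) atTop (𝓝 (f u))
        → Tendsto (fun n => ∫ t in Ioo a b, moll n (t - u) * (-f) t) atTop (𝓝 ((-f) u)) := by
      intro u hu
      simpa only [Pi.neg_apply, mul_neg, integral_neg] using hu.neg
    have u2 := three_point_le (f := -f) hf.neg (fun φ hφ _ => by
      simp only [Pi.neg_apply, mul_neg, integral_neg, hcd φ hφ, neg_zero, le_refl])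
      h1 h2 h3 h4 (hneg hx') (hneg hy') (hneg hz')
    simp only [Pi.neg_apply] at u2
    linarith
  have hslope : ∀ c d : ℝ, a ≤ c → c < d → d ≤ b →
      (∀ φ, IsTestFunction c d φ → ∫ t in Ioo a b, deriv (deriv φ) t * f t = 0) →
      ∃ A, ∀ x ∈ S, ∀ y ∈ S, c < x → x < y → y < d → f y - f x = A * (y - x) := by
    intro c d hc hcd hd htest
    have haff' := haff c d hc hd htest
    obtain ⟨p, hp, hpc, hpd⟩ := hdense.exists_between hcd
    obtain ⟨q, hq, hqp, hqd⟩ := hdense.exists_between hpd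
    refine ⟨(f q - f p) / (q - p), ?_⟩
    have hlin : ∀ x ∈ S, c < x → x < d → f x = f p + (f q - f p) / (q - p) * (x - p) := by
      intro x hx hxc hxd
      have hqp' : q - p ≠ 0 := by linarith
      field_simp
      rcases lt_trichotomy x p with hlt | rfl | hgt
      · linarith [haff' x hx p hp q hq hxc hlt hqp hqd]
      · ring
      · rcases lt_trichotomy x q with hlt' | rfl | hgt'
        · linarith [haff' p hp x hx q hq hpc hgt hlt' hqd]
        · ring
        · linarith [haff' p hp q hq x hx hpc hqp hgt' hxd]
    intro x hx y hy h1 h2 h3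
    rw [hlin x hx h1 (by linarith), hlin y hy (by linarith) h3]
    ring
  obtain ⟨A, hA⟩ := hslope a c le_rfl hac hcb.le hl
  obtain ⟨B, hB⟩ := hslope d b had.le hdb le_rfl hr
  -- Slopes of a convex function increase. Two points x < y left of both c and u realize the initial
  -- slope A, and two three-point inequalities carry it from (x, y) to (y, u) to (u, v). The upper
  -- bound by the final slope B is the mirror image.
  have hlow : ∀ u ∈ S, ∀ v ∈ S, a < u → u < v → v < b → A * (v - u) ≤ f v - f u := by
    intro u hu v hv h1 h2 h3
    obtain ⟨x, hx, hxa, hxm⟩ := hdense.exists_between (lt_min hac h1)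
    obtain ⟨y, hy, hyx, hym⟩ := hdense.exists_between hxm
    have hyc := hym.trans_le (min_le_left _ _)
    have hyu := hym.trans_le (min_le_right _ _)
    have e := hA x hx y hy hxa hyx hyc
    have c1 := hconv x hx y hy u hu hxa hyx hyu (by linarith)
    have c2 := hconv y hy u hu v hv (by linarith) hyu h2 h3
    have s1 : A * (u - y) ≤ f u - f y := by
      refine le_of_mul_le_mul_left ?_ (sub_pos.2 hyx)
      have hfx : f x = f y - A * (y - x) := by linarith
      rw [hfx] at c1
      linarith
    refine le_of_mul_le_mul_left ?_ (sub_pos.2 hyu)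
    have := mul_le_mul_of_nonneg_left s1 (sub_pos.2 h2).le
    linarith
  have hup : ∀ u ∈ S, ∀ v ∈ S, a < u → u < v → v < b → f v - f u ≤ B * (v - u) := by
    intro u hu v hv h1 h2 h3
    obtain ⟨y, hy, hym, hyb⟩ := hdense.exists_between (max_lt hdb h3)
    obtain ⟨x, hx, hxm, hxy⟩ := hdense.exists_between hym
    have hxd := (le_max_left _ _).trans_lt hxm
    have hxv := (le_max_right _ _).trans_lt hxm
    have e := hB x hx y hy hxd hxy hyb
    have c1 := hconv v hv x hx y hy (by linarith) hxv hxy hyb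
    have c2 := hconv u hu v hv x hx h1 h2 hxv (by linarith)
    have s1 : f x - f v ≤ B * (x - v) := by
      refine le_of_mul_le_mul_left ?_ (sub_pos.2 hxy)
      have hfy : f y = f x + B * (y - x) := by linarith
      rw [hfy] at c1
      linarith
    refine le_of_mul_le_mul_left ?_ (sub_pos.2 hxv)
    have := mul_le_mul_of_nonneg_left s1 (sub_pos.2 h2).le
    linarith
  have hlip : LipschitzOnWith (Real.toNNReal (max |A| |B|)) f (S ∩ Ioo a b) := by
    have key : ∀ u ∈ S ∩ Ioo a b, ∀ v ∈ S ∩ Ioo a b, u < v →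
        |f v - f u| ≤ max |A| |B| * (v - u) := by
      intro u hu v hv huv
      have l1 := hlow u hu.1 v hv.1 hu.2.1 huv hv.2.2
      have l2 := hup u hu.1 v hv.1 hu.2.1 huv hv.2.2
      have hvu : 0 ≤ v - u := by linarith
      rw [abs_le]
      constructor
      · have : -max |A| |B| ≤ A := by linarith [neg_abs_le A, le_max_left |A| |B|]
        linarith [mul_le_mul_of_nonneg_right this hvu]
      · have : B ≤ max |A| |B| := (le_abs_self B).trans (le_max_right _ _)
        linarith [mul_le_mul_of_nonneg_right this hvu]
    refine LipschitzOnWith.of_dist_le_mul fun u hu v hv => ?_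
    rw [Real.coe_toNNReal _ ((abs_nonneg A).trans (le_max_left _ _)), Real.dist_eq, Real.dist_eq]
    rcases lt_trichotomy u v with hlt | rfl | hgt
    · rw [abs_sub_comm, abs_sub_comm u v, abs_of_pos (sub_pos.2 hlt)]
      exact key u hu v hv hlt
    · simp
    · rw [abs_of_pos (sub_pos.2 hgt)]
      exact key v hv u hu hgt
  -- The Lipschitz bound is known only on the set of full measure S ∩ (a, b), so the representative
  -- is a Lipschitz extension from it.
  obtain ⟨g, hg, hgf⟩ := hlip.extend_real
  refine ⟨_, g, hg, ?_⟩
  filter_upwards [hae] with x hx hxm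
  exact hgf ⟨hx, hxm⟩

/-- Regularity for the differential inequality `2 f'' ≥ g'` in the sense of distributions, with
equality near the endpoints. -/
theorem exists_lipschitzWith_ae_eq_sub {f g : ℝ → ℝ} {a b c d : ℝ} (hac : a < c) (hcb : c < b)
    (had : a < d) (hdb : d < b) (hf : IntegrableOn f (Ioo a b)) (hg : IntegrableOn g (Ioo a b))
    (h : ∀ φ, IsTestFunction a b φ → (∀ t, 0 ≤ φ t) →
      0 ≤ ∫ t in Ioo a b, (deriv (deriv φ) t * f t + deriv φ t * g t))
    (hl : ∀ φ, IsTestFunction a c φ →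
      0 ≤ ∫ t in Ioo a b, (deriv (deriv φ) t * f t + deriv φ t * g t))
    (hr : ∀ φ, IsTestFunction d b φ →
      0 ≤ ∫ t in Ioo a b, (deriv (deriv φ) t * f t + deriv φ t * g t)) :
    ∃ (K : ℝ≥0) (k : ℝ → ℝ), LipschitzWith K k ∧
      ∀ᵐ x, x ∈ Ioo a b → f x = k x + ∫ t in a..x, g t := by
  have hab : a < b := hac.trans hcb
  have hgi : IntervalIntegrable g volume a b :=
    (intervalIntegrable_iff_integrableOn_Ioo_of_le hab.le).2 hg
  have hacc := hgi.absolutelyContinuousOnInterval_intervalIntegral (c := a) left_mem_uIcc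
  have hder : ∀ᵐ x, x ∈ Ioo a b → HasDerivAt (fun x => ∫ t in a..x, g t) (g x) x := by
    filter_upwards [hgi.ae_hasDerivAt_integral] with x hx hxm
    exact hx (Icc_subset_uIcc (Ioo_subset_Icc_self hxm)) a left_mem_uIcc
  have hGi : IntegrableOn (fun x => ∫ t in a..x, g t) (Ioo a b) :=
    (hacc.continuousOn.integrableOn_compact isCompact_uIcc).mono_set
      (Ioo_subset_Icc_self.trans Icc_subset_uIcc)
  -- Integration by parts against φ' absorbs g into its primitive, reducing the inequality to plain
  -- convexity of f - ∫ g.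
  have key : ∀ φ, IsTestFunction a b φ →
      ∫ t in Ioo a b, deriv (deriv φ) t * (f t - ∫ s in a..t, g s) =
        ∫ t in Ioo a b, (deriv (deriv φ) t * f t + deriv φ t * g t) := by
    intro φ hφ
    have h2 := integral_deriv_mul_eq_neg hab.le hacc hder hφ.deriv
    simp only [mul_sub]
    rw [integral_sub (hφ.deriv.deriv.integrable_mul hf) (hφ.deriv.deriv.integrable_mul hGi), h2,
      integral_add (hφ.deriv.deriv.integrable_mul hf) (hφ.deriv.integrable_mul hg), sub_neg_eq_add]
  have heq : ∀ φ, IsTestFunction a b φ →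
      (0 ≤ ∫ t in Ioo a b, (deriv (deriv φ) t * f t + deriv φ t * g t)) →
      (0 ≤ ∫ t in Ioo a b, (deriv (deriv fun x => -φ x) t * f t + deriv (fun x => -φ x) t * g t)) →
      ∫ t in Ioo a b, deriv (deriv φ) t * (f t - ∫ s in a..t, g s) = 0 := by
    intro φ hφ h1 h2
    have e1 : (deriv fun x => -φ x) = fun x => -deriv φ x := by
      ext x
      exact deriv.fun_neg
    have e2 : (deriv fun x => -deriv φ x) = fun x => -deriv (deriv φ) x := by
      ext x
      exact deriv.fun_neg
    rw [e1, e2] at h2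
    have e3 : (fun t => -deriv (deriv φ) t * f t + -deriv φ t * g t) =
        fun t => -(deriv (deriv φ) t * f t + deriv φ t * g t) := by
      ext t
      ring
    rw [e3, integral_neg] at h2
    rw [key φ hφ]
    linarith
  obtain ⟨K, k, hk, hfk⟩ := exists_lipschitzWith_ae_eq (f := fun x => f x - ∫ t in a..x, g t)
    hac hcb had hdb (hf.sub hGi) (fun φ hφ hpos => by rw [key φ hφ]; exact h φ hφ hpos)
    (fun φ hφ => heq φ (hφ.mono le_rfl hcb.le) (hl φ hφ) (hl _ hφ.neg))
    (fun φ hφ => heq φ (hφ.mono had.le le_rfl) (hr φ hφ) (hr _ hφ.neg))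
  refine ⟨K, k, hk, ?_⟩
  filter_upwards [hfk] with x hx hxm
  linarith [hx hxm]

/-! ### Normalization of vectors -/

/-- Away from the origin v ↦ v/‖v‖ is Lipschitz; this is how the unit tangent inherits absolute
continuity from the derivative of the curve. -/
theorem dist_normalize_le {E : Type*} [NormedAddCommGroup E] [NormedSpace ℝ E] {u v : E} {c : ℝ}
    (hc : 0 < c) (hu : c ≤ ‖u‖) (hv : c ≤ ‖v‖) :
    dist (‖u‖⁻¹ • u) (‖v‖⁻¹ • v) ≤ 2 / c * dist u v := by
  have hu0 : 0 < ‖u‖ := hc.trans_le hu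
  have hv0 : 0 < ‖v‖ := hc.trans_le hv
  have h1 : ‖u‖⁻¹ • u - ‖v‖⁻¹ • v = ‖u‖⁻¹ • (u - v) + ((‖v‖ - ‖u‖) * (‖u‖⁻¹ * ‖v‖⁻¹)) • v := by
    have : (‖v‖ - ‖u‖) * (‖u‖⁻¹ * ‖v‖⁻¹) = ‖u‖⁻¹ - ‖v‖⁻¹ := by
      field_simp
    rw [this, smul_sub, sub_smul]
    abel
  have h2 : |‖v‖ - ‖u‖| ≤ ‖u - v‖ := by
    rw [← norm_neg (u - v), neg_sub]
    exact abs_norm_sub_norm_le v u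
  rw [dist_eq_norm, dist_eq_norm, h1]
  calc _ ≤ ‖u‖⁻¹ * ‖u - v‖ + |‖v‖ - ‖u‖| * (‖u‖⁻¹ * ‖v‖⁻¹) * ‖v‖ := by
        refine (norm_add_le _ _).trans (le_of_eq ?_)
        rw [norm_smul, norm_smul, norm_mul, norm_mul, norm_inv, norm_inv, norm_norm, norm_norm,
          Real.norm_eq_abs]
    _ = ‖u‖⁻¹ * ‖u - v‖ + |‖v‖ - ‖u‖| * ‖u‖⁻¹ := by
        field_simp
    _ ≤ ‖u‖⁻¹ * ‖u - v‖ + ‖u - v‖ * ‖u‖⁻¹ := by gcongr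
    _ = 2 * ‖u‖⁻¹ * ‖u - v‖ := by ring
    _ ≤ 2 / c * ‖u - v‖ := by
        rw [div_eq_mul_inv]
        gcongr

/-- The derivative of a unit vector is orthogonal to it. Hence u' splits into the orthogonal parts
‖u‖ n' and ‖u‖' u/‖u‖, and Pythagoras gives the bound. The inequality is enough, since energies of
varied curves are only estimated from above. -/
theorem hasDerivAt_normalize {E : Type*} [NormedAddCommGroup E] [InnerProductSpace ℝ E]
    {u : ℝ → E} {u' : E} {x : ℝ} (h : HasDerivAt u u' x) (hx : u x ≠ 0) :
    ∃ n', HasDerivAt (fun y => ‖u y‖⁻¹ • u y) n' x ∧ ‖n'‖ ≤ ‖u'‖ / ‖u x‖ := by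
  have hpos : 0 < ‖u x‖ := norm_pos_iff.2 hx
  have hn : DifferentiableAt ℝ (fun y => ‖u y‖) x := h.differentiableAt.norm ℝ hx
  have hT : DifferentiableAt ℝ (fun y => ‖u y‖⁻¹ • u y) x :=
    (hn.fun_inv hpos.ne').fun_smul h.differentiableAt
  set T := fun y => ‖u y‖⁻¹ • u y
  refine ⟨deriv T x, hT.hasDerivAt, ?_⟩
  have hne : ∀ᶠ y in 𝓝 x, u y ≠ 0 := h.continuousAt.eventually_ne hx
  have hunit : ∀ y, u y ≠ 0 → ‖T y‖ = 1 := fun y hy =>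
    norm_smul_inv_norm (𝕜 := ℝ) hy
  have horth : inner ℝ (T x) (deriv T x) = 0 := by
    have h1 := hT.hasDerivAt.inner ℝ hT.hasDerivAt
    have h2 : HasDerivAt (fun y => inner ℝ (T y) (T y)) 0 x := by
      refine (hasDerivAt_const x (1 : ℝ)).congr_of_eventuallyEq ?_
      filter_upwards [hne] with y hy
      rw [real_inner_self_eq_norm_sq, hunit y hy, one_pow]
    have h3 := h1.unique h2
    rw [real_inner_comm] at h3
    rw [real_inner_comm]
    linarith
  have hu' : u' = ‖u x‖ • deriv T x + deriv (fun y => ‖u y‖) x • T x := by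
    have h1 := hn.hasDerivAt.fun_smul hT.hasDerivAt
    refine h.unique (h1.congr_of_eventuallyEq ?_)
    filter_upwards [hne] with y hy
    rw [smul_smul, mul_inv_cancel₀ (norm_ne_zero_iff.2 hy), one_smul]
  rw [le_div_iff₀ hpos]
  refine (pow_le_pow_iff_left₀ (by positivity) (norm_nonneg _) two_ne_zero).1 ?_
  have hsq : ‖u'‖ ^ 2 = ‖u x‖ ^ 2 * ‖deriv T x‖ ^ 2 + deriv (fun y => ‖u y‖) x ^ 2 := by
    rw [hu', norm_add_sq_real, inner_smul_left, inner_smul_right, real_inner_comm, horth, norm_smul,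
      norm_smul, hunit x hx, Real.norm_eq_abs, Real.norm_eq_abs, mul_pow, mul_pow, sq_abs, sq_abs]
    ring
  rw [hsq, mul_pow]
  nlinarith [sq_nonneg (deriv (fun y => ‖u y‖) x)]

/-! ### Tangent data of an immersed curve -/

/-- `p` is the derivative of `γ` on `[0, 1]`, extended to the real line by constants, and `q` is the
almost everywhere derivative of `p`. -/
structure TangentData (γ p q : ℝ → Plane) : Prop where
  memLp : MemLp q 2
  integrable : Integrable q
  tangent_eq : ∀ x, p x = p 0 + ∫ t in (0 : ℝ)..x, q t
  exists_pos_le : ∃ c, 0 < c ∧ ∀ x, c ≤ ‖p x‖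
  curve_eq : ∀ x ∈ Icc (0 : ℝ) 1, γ x = γ 0 + ∫ t in (0 : ℝ)..x, p t

theorem ae_eq_const_add_integral_plane {f g : ℝ → Plane} {a b : ℝ} (hab : a < b)
    (hf : IntegrableOn f (Ioo a b)) (hg : IntegrableOn g (Ioo a b)) (h : HasWeakDeriv a b f g) :
    ∃ c : Plane, ∀ᵐ x, x ∈ Ioo a b → f x = c + ∫ t in a..x, g t := by
  have hi (i : Fin 2) := ae_eq_const_add_integral hab (integrable_plane_iff.1 hf i)
    (integrable_plane_iff.1 hg i) fun φ hφ => h.apply hf hg hφ i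
  choose c hc using hi
  refine ⟨WithLp.toLp 2 c, ?_⟩
  filter_upwards [hc 0, hc 1] with x h0 h1 hx
  have hgx : IntervalIntegrable g volume a x :=
    ((intervalIntegrable_iff_integrableOn_Ioo_of_le hab.le).2 hg).mono_set
      (uIcc_subset_uIcc_left (Icc_subset_uIcc (Ioo_subset_Icc_self hx)))
  ext i
  rw [PiLp.add_apply, intervalIntegral_plane_apply hgx]
  fin_cases i
  · exact h0 hx
  · exact h1 hx

theorem integrableOn_of_memLp_two {E : Type*} [NormedAddCommGroup E] {f : ℝ → E} {a b : ℝ}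
    (h : MemLp f 2 (volume.restrict (Ioo a b))) : IntegrableOn f (Ioo a b) :=
  h.integrable (by norm_num)

theorem IsImmersedW22.exists_tangentData {γ : ℝ → Plane} (h : IsImmersedW22 γ) :
    ∃ p q, TangentData γ p q := by
  obtain ⟨hγ2, g1, hw1, hg1, g2, hw2, hg2⟩ := h.memSobolev
  have hg2' : MemLp g2 2 (volume.restrict (Ioo 0 1)) := hg2
  have hγi := integrableOn_of_memLp_two hγ2
  have hg1i := integrableOn_of_memLp_two hg1
  have hg2i := integrableOn_of_memLp_two hg2'
  obtain ⟨c, hc⟩ := ae_eq_const_add_integral_plane zero_lt_one hg1i hg2i hw2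
  obtain ⟨d, hd⟩ := ae_eq_const_add_integral_plane zero_lt_one hγi hg1i hw1
  set q : ℝ → Plane := (Ioo 0 1).indicator g2 with hq
  have hqi : Integrable q := hg2i.integrable_indicator measurableSet_Ioo
  set p : ℝ → Plane := fun x => c + ∫ t in (0 : ℝ)..x, q t with hp
  have hpc : Continuous p :=
    continuous_const.add (intervalIntegral.continuous_primitive (fun _ _ => hqi.intervalIntegrable) 0)
  have hg1p : ∀ᵐ x, x ∈ Ioo (0 : ℝ) 1 → g1 x = p x := by
    filter_upwards [hc] with x hx hxm
    rw [hx hxm, hp]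
    congr 1
    simp only [intervalIntegral.integral_of_le hxm.1.le]
    refine setIntegral_congr_fun measurableSet_Ioc fun t ht => ?_
    rw [hq, indicator_of_mem (show t ∈ Ioo (0 : ℝ) 1 from ⟨ht.1, ht.2.trans_lt hxm.2⟩)]
  set P : ℝ → Plane := fun x => ∫ t in (0 : ℝ)..x, p t with hP
  have hPd : ∀ x, HasDerivAt P (p x) x := fun x => (hpc.integral_hasStrictDerivAt 0 x).hasDerivAt
  have hPc : Continuous P := continuous_iff_continuousAt.2 fun x => (hPd x).continuousAt
  -- Two continuous functions equal almost everywhere on [0, 1] are equal on it, endpoints included.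
  have hγP : EqOn γ (fun x => d + P x) (Icc 0 1) := by
    refine Measure.eqOn_Icc_of_ae_eq (μ := volume) zero_ne_one ?_ h.contDiffOn.continuousOn
      (continuous_const.add hPc).continuousOn
    rw [← Measure.restrict_congr_set Ioo_ae_eq_Icc, EventuallyEq, ae_restrict_iff' measurableSet_Ioo]
    filter_upwards [hd] with x hx hxm
    rw [hx hxm]
    congr 1
    refine intervalIntegral.integral_congr_ae ?_
    filter_upwards [hg1p] with t ht htm
    rw [uIoc_of_le hxm.1.le] at htm
    exact ht ⟨htm.1, htm.2.trans_lt hxm.2⟩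
  have hcurve : ∀ x ∈ Icc (0 : ℝ) 1, γ x = γ 0 + P x := by
    intro x hx
    rw [hγP hx, hγP (left_mem_Icc.2 zero_le_one)]
    simp [hP]
  have hpne : ∀ x ∈ Icc (0 : ℝ) 1, p x ≠ 0 := by
    intro x hx
    have h1 : HasDerivWithinAt γ (p x) (Icc 0 1) x :=
      ((hPd x).const_add (γ 0)).hasDerivWithinAt.congr hcurve (hcurve x hx)
    rw [← h1.derivWithin (uniqueDiffOn_Icc zero_lt_one x hx)]
    exact h.deriv_ne_zero x hx
  obtain ⟨x0, hx0, hmin⟩ := isCompact_Icc.exists_isMinOn (nonempty_Icc.2 (zero_le_one (α := ℝ)))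
    hpc.norm.continuousOn
  -- The second derivative is extended by zero, so p is constant on each side of [0, 1] and its
  -- positive minimum modulus there is a lower bound on the whole line.
  have hclamp : ∀ x, ∃ y ∈ Icc (0 : ℝ) 1, p x = p y := by
    intro x
    rcases le_total x 0 with hx | hx
    · refine ⟨0, by simp, ?_⟩
      simp only [hp, intervalIntegral.integral_same]
      congr 1
      refine intervalIntegral.integral_zero_ae (Eventually.of_forall fun t ht => ?_)
      rw [uIoc_of_ge hx] at ht
      exact indicator_of_notMem (fun h' => absurd h'.1 (not_lt.2 ht.2)) _
    · rcases le_total x 1 with hx1 | hx1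
      · exact ⟨x, ⟨hx, hx1⟩, rfl⟩
      · refine ⟨1, by simp, ?_⟩
        simp only [hp]
        congr 1
        rw [← intervalIntegral.integral_add_adjacent_intervals (b := (1 : ℝ))
          hqi.intervalIntegrable hqi.intervalIntegrable]
        rw [add_eq_left]
        refine intervalIntegral.integral_zero_ae (Eventually.of_forall fun t ht => ?_)
        rw [uIoc_of_le hx1] at ht
        exact indicator_of_notMem (fun h' => absurd h'.2 (not_lt.2 ht.1.le)) _
  refine ⟨p, q, (memLp_indicator_iff_restrict measurableSet_Ioo).2 hg2', hqi, fun x => ?_,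
    ⟨‖p x0‖, norm_pos_iff.2 (hpne x0 hx0), fun x => ?_⟩, hcurve⟩
  · simp [hp]
  · obtain ⟨y, hy, hxy⟩ := hclamp x
    rw [hxy]
    exact hmin hy

/-- The arclength function with speed `‖p‖`. -/
def arcl (p : ℝ → Plane) (x : ℝ) : ℝ := ∫ t in (0 : ℝ)..x, ‖p t‖

/-- The unit tangent. -/
def utan (p : ℝ → Plane) (x : ℝ) : Plane := ‖p x‖⁻¹ • p x

/-- The curvature vector in terms of the derivative `p`. -/
def curv (p : ℝ → Plane) (x : ℝ) : Plane := ‖p x‖⁻¹ • deriv (utan p) x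

/-! ### Arclength, unit tangent and curvature expressed through the derivative of the curve -/

namespace TangentData

variable {γ p q : ℝ → Plane}

theorem continuous (D : TangentData γ p q) : Continuous p := by
  have : p = fun x => p 0 + ∫ t in (0 : ℝ)..x, q t := funext D.tangent_eq
  rw [this]
  exact continuous_const.add
    (intervalIntegral.continuous_primitive (fun _ _ => D.integrable.intervalIntegrable) 0)

theorem norm_pos (D : TangentData γ p q) (x : ℝ) : 0 < ‖p x‖ := by
  obtain ⟨c, hc, h⟩ := D.exists_pos_le
  exact hc.trans_le (h x)

theorem ne_zero (D : TangentData γ p q) (x : ℝ) : p x ≠ 0 := norm_pos_iff.1 (D.norm_pos x)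

theorem absolutelyContinuousOnInterval (D : TangentData γ p q) {a : ℝ} (ha : 0 ≤ a) :
    AbsolutelyContinuousOnInterval p 0 a := by
  have : p = fun x => p 0 + ∫ t in (0 : ℝ)..x, q t := funext D.tangent_eq
  rw [this]
  exact (absolutelyContinuousOnInterval_const _ _ _).fun_add
    (absolutelyContinuousOnInterval_integral_plane ha D.integrable.intervalIntegrable)

theorem ae_hasDerivAt (D : TangentData γ p q) : ∀ᵐ x, HasDerivAt p (q x) x := by
  filter_upwards [LocallyIntegrable.ae_hasDerivAt_integral D.integrable.locallyIntegrable] with x hx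
  have : p = fun x => p 0 + ∫ t in (0 : ℝ)..x, q t := funext D.tangent_eq
  rw [this]
  exact (hx 0).const_add _

theorem hasDerivAt_arcl (D : TangentData γ p q) (x : ℝ) : HasDerivAt (arcl p) ‖p x‖ x :=
  (D.continuous.norm.integral_hasStrictDerivAt 0 x).hasDerivAt

theorem deriv_arcl (D : TangentData γ p q) : deriv (arcl p) = fun x => ‖p x‖ :=
  funext fun x => (D.hasDerivAt_arcl x).deriv

theorem contDiff_arcl (D : TangentData γ p q) : ContDiff ℝ 1 (arcl p) := by
  rw [contDiff_one_iff_deriv, D.deriv_arcl]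
  exact ⟨fun x => (D.hasDerivAt_arcl x).differentiableAt, D.continuous.norm⟩

theorem strictMono_arcl (D : TangentData γ p q) : StrictMono (arcl p) :=
  strictMono_of_deriv_pos fun x => by
    rw [D.deriv_arcl]
    exact D.norm_pos x

theorem continuous_arcl (D : TangentData γ p q) : Continuous (arcl p) := D.contDiff_arcl.continuous

theorem arcl_zero : arcl p 0 = 0 := intervalIntegral.integral_same

theorem arcl_one_pos (D : TangentData γ p q) : 0 < arcl p 1 := by
  have := D.strictMono_arcl zero_lt_one
  rwa [arcl_zero] at this

theorem norm_utan (D : TangentData γ p q) (x : ℝ) : ‖utan p x‖ = 1 :=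
  norm_smul_inv_norm (𝕜 := ℝ) (D.ne_zero x)

theorem smul_utan (D : TangentData γ p q) (x : ℝ) : ‖p x‖ • utan p x = p x := by
  rw [utan, smul_smul, mul_inv_cancel₀ (D.norm_pos x).ne', one_smul]

theorem continuous_utan (D : TangentData γ p q) : Continuous (utan p) :=
  (D.continuous.norm.inv₀ fun x => (D.norm_pos x).ne').smul D.continuous

theorem absolutelyContinuousOnInterval_utan (D : TangentData γ p q) {a : ℝ} (ha : 0 ≤ a) :
    AbsolutelyContinuousOnInterval (utan p) 0 a := by
  obtain ⟨c, hc, h⟩ := D.exists_pos_le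
  exact absolutelyContinuousOnInterval_of_dist_le (D.absolutelyContinuousOnInterval ha)
    fun x _ y _ => dist_normalize_le hc (h x) (h y)

theorem absolutelyContinuousOnInterval_norm (D : TangentData γ p q) {a : ℝ} (ha : 0 ≤ a) :
    AbsolutelyContinuousOnInterval (fun x => ‖p x‖) 0 a :=
  absolutelyContinuousOnInterval_of_dist_le (K := 1) (D.absolutelyContinuousOnInterval ha)
    fun x _ y _ => by
      rw [one_mul, Real.dist_eq, dist_eq_norm]
      exact abs_norm_sub_norm_le _ _

/-- Almost everywhere, `κ = T' / v`, and it is controlled by the second derivative. -/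
theorem ae_hasDerivAt_utan (D : TangentData γ p q) :
    ∀ᵐ x, HasDerivAt (utan p) (‖p x‖ • curv p x) x ∧ ‖curv p x‖ ≤ ‖q x‖ / ‖p x‖ ^ 2 := by
  filter_upwards [D.ae_hasDerivAt] with x hx
  obtain ⟨n', hn, hle⟩ := hasDerivAt_normalize hx (D.ne_zero x)
  have hn' : HasDerivAt (utan p) n' x := hn
  have hpos := D.norm_pos x
  constructor
  · rw [curv, hn'.deriv, smul_smul, mul_inv_cancel₀ hpos.ne', one_smul]
    exact hn
  · rw [curv, hn'.deriv, norm_smul, norm_inv, norm_norm]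
    calc ‖p x‖⁻¹ * ‖n'‖ ≤ ‖p x‖⁻¹ * (‖q x‖ / ‖p x‖) := by gcongr
      _ = ‖q x‖ / ‖p x‖ ^ 2 := by field_simp

theorem memLp_curv (D : TangentData γ p q) : MemLp (curv p) 2 (volume.restrict (Ioo 0 1)) := by
  obtain ⟨c, hc, h⟩ := D.exists_pos_le
  have hm : AEStronglyMeasurable (curv p) (volume.restrict (Ioo 0 1)) :=
    ((D.continuous.norm.inv₀ fun x => (D.norm_pos x).ne').aestronglyMeasurable).smul
      (stronglyMeasurable_deriv _).aestronglyMeasurable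
  refine MemLp.of_le_mul (c := (c ^ 2)⁻¹) (D.memLp.restrict _) hm (ae_restrict_of_ae ?_)
  filter_upwards [D.ae_hasDerivAt_utan] with x hx
  refine hx.2.trans ?_
  rw [div_eq_inv_mul]
  gcongr
  exact h x

theorem integrableOn_sq_curv (D : TangentData γ p q) :
    IntegrableOn (fun x => ‖curv p x‖ ^ 2) (Ioo 0 1) := by
  have := D.memLp_curv.integrable_norm_pow (by norm_num)
  simpa [IntegrableOn] using this

theorem hasDerivAt_curve (D : TangentData γ p q) {x : ℝ} (hx : x ∈ Ioo (0 : ℝ) 1) :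
    HasDerivAt γ (p x) x := by
  have h := ((D.continuous.integral_hasStrictDerivAt 0 x).hasDerivAt).const_add (γ 0)
  refine h.congr_of_eventuallyEq ?_
  filter_upwards [Ioo_mem_nhds hx.1 hx.2] with y hy
  exact D.curve_eq y (Ioo_subset_Icc_self hy)

theorem arclength_eq (D : TangentData γ p q) {x : ℝ} (hx : x ∈ Icc (0 : ℝ) 1) :
    arclength γ x = arcl p x := by
  refine intervalIntegral.integral_congr_ae ?_
  have h1 : ∀ᵐ t : ℝ, t ≠ 1 := by simp [ae_iff, measure_singleton]
  filter_upwards [h1] with t ht htm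
  rw [uIoc_of_le hx.1] at htm
  rw [(D.hasDerivAt_curve ⟨htm.1, lt_of_le_of_ne (htm.2.trans hx.2) ht⟩).deriv]

theorem curvatureVector_eq (D : TangentData γ p q) {x : ℝ} (hx : x ∈ Ioo (0 : ℝ) 1) :
    curvatureVector γ x = curv p x := by
  have h : arcDeriv γ γ =ᶠ[𝓝 x] utan p := by
    filter_upwards [Ioo_mem_nhds hx.1 hx.2] with y hy
    rw [arcDeriv, (D.hasDerivAt_curve hy).deriv, utan]
  rw [curvatureVector, arcDeriv, (D.hasDerivAt_curve hx).deriv, h.deriv_eq, curv]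

theorem bendingEnergy_eq (D : TangentData γ p q) :
    bendingEnergy γ = ∫ x in Ioo (0 : ℝ) 1, ‖curv p x‖ ^ 2 * ‖p x‖ := by
  rw [bendingEnergy, intervalIntegral.integral_of_le zero_le_one, integral_Ioc_eq_integral_Ioo]
  refine setIntegral_congr_fun measurableSet_Ioo fun x hx => ?_
  rw [D.curvatureVector_eq hx, (D.hasDerivAt_curve hx).deriv]

theorem curveLength_eq (D : TangentData γ p q) : curveLength γ = ∫ x in Ioo (0 : ℝ) 1, ‖p x‖ := by
  rw [curveLength, D.arclength_eq (by simp), arcl, intervalIntegral.integral_of_le zero_le_one,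
    integral_Ioc_eq_integral_Ioo]

end TangentData

/-! ### Pointwise expansion of the energy density -/

/-- A second order upper bound in the variable m² - 1, chosen because ‖T + t a‖² - 1 is a polynomial
in t. The coefficient 24 is far from sharp. -/
theorem one_div_cube_le {m : ℝ} (hm : 1 / 2 ≤ m) :
    1 / m ^ 3 ≤ 1 - 3 / 2 * (m ^ 2 - 1) + 24 * (m ^ 2 - 1) ^ 2 := by
  have h0 : 0 < m := by linarith
  rw [div_le_iff₀ (by positivity)]
  -- After multiplication by m³, right side minus left side is (m - 1)² times this expression.
  have key : 0 ≤ 24 * (m + 1) ^ 2 * m ^ 3 - (3 / 2 * m ^ 3 + 3 * m ^ 2 + 2 * m + 1) := by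
    have e1 : 1 / 8 ≤ m ^ 3 := by
      have := pow_le_pow_left₀ (by norm_num) hm 3
      norm_num at this ⊢
      exact this
    have e2 : 1 / 4 * m ≤ m ^ 3 := by nlinarith [mul_self_nonneg (m - 1 / 2), mul_pos h0 h0]
    have e3 : 1 / 2 * m ^ 2 ≤ m ^ 3 := by nlinarith [mul_pos h0 h0]
    have e4 : 0 ≤ m ^ 5 := by positivity
    have e5 : 0 ≤ m ^ 4 := by positivity
    nlinarith
  have := mul_nonneg (sq_nonneg (m - 1)) key
  nlinarith [this]

section Density

variable {E : Type*} [NormedAddCommGroup E] [InnerProductSpace ℝ E]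

/-- From r ≤ (1 + r²)/2 applied to the norm r, whose square is explicit. -/
theorem norm_add_smul_le_of_norm_eq_one {T a : E} {P t : ℝ} (hT : ‖T‖ = 1) (ha : ‖a‖ ≤ P) :
    ‖T + t • a‖ ≤ 1 + t * inner ℝ T a + t ^ 2 * (P ^ 2 / 2) := by
  have h1 : ‖T + t • a‖ ^ 2 = 1 + 2 * (t * inner ℝ T a) + t ^ 2 * ‖a‖ ^ 2 := by
    rw [norm_add_sq_real, hT, inner_smul_right, norm_smul, mul_pow, Real.norm_eq_abs, sq_abs]
    ring
  have h2 : ‖a‖ ^ 2 ≤ P ^ 2 := pow_le_pow_left₀ (norm_nonneg _) ha 2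
  have h3 := mul_le_mul_of_nonneg_left h2 (sq_nonneg t)
  nlinarith [sq_nonneg (‖T + t • a‖ - 1)]

-- With T and k the tangent and curvature vector of γ and a = φ' w, b = φ'' w, the left side bounds
-- the varied bending density per unit of old arclength: the curvature scales like |U|⁻², the length
-- element like |U|, whence the cube. The t² error is at most a constant times P² (1 + ‖k‖²), which
-- is integrable when k is only square integrable. The condition t P ≤ 1/4 keeps the denominator
-- away from zero.
set_option maxHeartbeats 1000000 in
theorem bending_density_le {T k a b : E} {P t : ℝ} (hT : ‖T‖ = 1) (ha : ‖a‖ ≤ P) (hb : ‖b‖ ≤ P)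
    (ht : 0 ≤ t) (htP : t * P ≤ 1 / 4) :
    ‖k + t • b‖ ^ 2 / ‖T + t • a‖ ^ 3 ≤
      ‖k‖ ^ 2 + t * (2 * inner ℝ k b - 3 * ‖k‖ ^ 2 * inner ℝ T a) +
        t ^ 2 * (500 * P ^ 2 * (1 + ‖k‖ ^ 2)) := by
  have hP : 0 ≤ P := (norm_nonneg a).trans ha
  set A := ‖k‖ ^ 2 with hA
  set B := inner ℝ k b with hB
  set α := inner ℝ T a with hα
  have hA0 : 0 ≤ A := by positivity
  have hαP : |α| ≤ P := by
    have := abs_real_inner_le_norm T a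
    rw [hT, one_mul] at this
    exact this.trans ha
  have hBP : |B| ≤ P * (1 + A) / 2 := by
    have h1 : |B| ≤ ‖k‖ * ‖b‖ := abs_real_inner_le_norm k b
    have h2 : ‖k‖ * ‖b‖ ≤ ‖k‖ * P := by gcongr
    nlinarith [sq_nonneg (‖k‖ - 1)]
  set m := ‖T + t • a‖ with hm
  have hm2 : m ^ 2 - 1 = 2 * t * α + t ^ 2 * ‖a‖ ^ 2 := by
    rw [hm, norm_add_sq_real, hT, inner_smul_right, norm_smul, mul_pow, Real.norm_eq_abs, sq_abs]
    ring
  have hmhalf : 1 / 2 ≤ m := by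
    have h1 : ‖T‖ ≤ m + ‖t • a‖ := by
      rw [hm]
      exact norm_le_add_norm_add T (t • a)
    have h2 : ‖t • a‖ ≤ t * P := by
      rw [norm_smul, Real.norm_of_nonneg ht]
      gcongr
    linarith
  have htP0 : 0 ≤ t * P := mul_nonneg ht hP
  have ha2 : ‖a‖ ^ 2 ≤ P ^ 2 := pow_le_pow_left₀ (norm_nonneg _) ha 2
  have hta2 : t ^ 2 * ‖a‖ ^ 2 ≤ t * P := by
    have := mul_le_mul_of_nonneg_left ha2 (sq_nonneg t)
    nlinarith
  have hta0 : 0 ≤ t ^ 2 * ‖a‖ ^ 2 := by positivity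
  have htα : |t * α| ≤ t * P := by
    rw [abs_mul, abs_of_nonneg ht]
    gcongr
  have hr : (m ^ 2 - 1) ^ 2 ≤ 9 * (t * P) ^ 2 := by
    have : |m ^ 2 - 1| ≤ 3 * (t * P) := by
      rw [hm2, abs_le]
      constructor <;> linarith [(abs_le.1 htα).1, (abs_le.1 htα).2]
    have h2 := pow_le_pow_left₀ (abs_nonneg _) this 2
    rw [sq_abs] at h2
    linarith
  have hM : 1 / m ^ 3 ≤ 1 - 3 * (t * α) + 216 * (t * P) ^ 2 := by
    have := one_div_cube_le hmhalf
    have e : 3 / 2 * (m ^ 2 - 1) = 3 * (t * α) + 3 / 2 * (t ^ 2 * ‖a‖ ^ 2) := by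
      rw [hm2]
      ring
    linarith
  set Q := ‖b‖ ^ 2 with hQ
  have hQ0 : 0 ≤ Q := by positivity
  have hQP : Q ≤ P ^ 2 := pow_le_pow_left₀ (norm_nonneg _) hb 2
  set N := ‖k + t • b‖ ^ 2 with hN
  have hNeq : N = A + 2 * t * B + t ^ 2 * Q := by
    rw [hN, norm_add_sq_real, inner_smul_right, norm_smul, mul_pow, Real.norm_eq_abs, sq_abs]
    ring
  have hN0 : 0 ≤ N := by positivity
  have hN2 : N ≤ 2 * (1 + A) := by
    have h1 : t * B ≤ t * P * (1 + A) / 2 := by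
      have := mul_le_mul_of_nonneg_left ((le_abs_self B).trans hBP) ht
      linarith
    have h2 : t * P * (1 + A) ≤ 1 / 4 * (1 + A) := by gcongr
    have h3 : t ^ 2 * Q ≤ 1 := by
      have := mul_le_mul_of_nonneg_left hQP (sq_nonneg t)
      nlinarith
    rw [hNeq]
    linarith
  have hαB : |α * B| ≤ P ^ 2 * (1 + A) / 2 := by
    rw [abs_mul]
    calc |α| * |B| ≤ P * (P * (1 + A) / 2) := by gcongr
      _ = P ^ 2 * (1 + A) / 2 := by ring
  have htαQ : |t * α * Q| ≤ P ^ 2 * (1 + A) := by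
    rw [abs_mul, abs_of_nonneg hQ0]
    calc |t * α| * Q ≤ 1 * P ^ 2 := by
          gcongr
          linarith
      _ ≤ P ^ 2 * (1 + A) := by nlinarith [sq_nonneg P]
  have hPA : Q ≤ P ^ 2 * (1 + A) := by nlinarith [sq_nonneg P]
  have hPN : P ^ 2 * N ≤ P ^ 2 * (2 * (1 + A)) := by gcongr
  calc N / m ^ 3 = N * (1 / m ^ 3) := by ring
    _ ≤ N * (1 - 3 * (t * α) + 216 * (t * P) ^ 2) := by gcongr
    _ = A + t * (2 * B - 3 * A * α) +
        t ^ 2 * (Q - 6 * (α * B) + 216 * (P ^ 2 * N) - 3 * (t * α * Q)) := by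
        have : N * (1 - 3 * (t * α) + 216 * (t * P) ^ 2) =
          (A + 2 * t * B + t ^ 2 * Q) * (1 - 3 * (t * α)) + t ^ 2 * (216 * (P ^ 2 * N)) := by
          rw [← hNeq]
          ring
        rw [this]
        ring
    _ ≤ A + t * (2 * B - 3 * A * α) + t ^ 2 * (500 * P ^ 2 * (1 + A)) := by
        gcongr
        have g1 := (abs_le.1 hαB).1
        have g2 := (abs_le.1 htαQ).1
        have g3 : 0 ≤ P ^ 2 * (1 + A) := by positivity
        nlinarith

end Density

/-! ### Perturbations of a curve -/

theorem memLp_of_continuousOn {E : Type*} [NormedAddCommGroup E] {f : ℝ → E} {a b : ℝ}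
    (r : ℝ≥0∞) (hf : ContinuousOn f (Icc a b)) : MemLp f r (volume.restrict (Ioo a b)) := by
  obtain ⟨C, hC⟩ := isCompact_Icc.exists_bound_of_continuousOn hf
  refine MemLp.of_bound
    ((hf.mono Ioo_subset_Icc_self).aestronglyMeasurable measurableSet_Ioo) C ?_
  rw [ae_restrict_iff' measurableSet_Ioo]
  exact Eventually.of_forall fun x hx => hC x (Ioo_subset_Icc_self hx)

/-- The perturbation of `γ` in the fixed direction `w` with profile `φ` in arclength. -/
def perturb (γ p : ℝ → Plane) (φ : ℝ → ℝ) (w : Plane) (t : ℝ) : ℝ → Plane :=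
  γ + t • fun x => φ (arcl p x) • w

/-- The derivative of `perturb` with respect to arclength. -/
def perturbTan (p : ℝ → Plane) (φ : ℝ → ℝ) (w : Plane) (t x : ℝ) : Plane :=
  utan p x + t • (deriv φ (arcl p x) • w)

namespace TangentData

variable {γ p q : ℝ → Plane} {φ : ℝ → ℝ} {a b : ℝ}

theorem hasDerivWithinAt_curve (D : TangentData γ p q) {x : ℝ} (hx : x ∈ Icc (0 : ℝ) 1) :
    HasDerivWithinAt γ (p x) (Icc 0 1) x :=
  (((D.continuous.integral_hasStrictDerivAt 0 x).hasDerivAt).const_add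
    (γ 0)).hasDerivWithinAt.congr D.curve_eq (D.curve_eq x hx)

theorem hasDerivAt_comp_arcl (D : TangentData γ p q) (hφ : IsTestFunction a b φ) (x : ℝ) :
    HasDerivAt (fun y => φ (arcl p y)) (deriv φ (arcl p x) * ‖p x‖) x :=
  (hφ.hasDerivAt (arcl p x)).comp x (D.hasDerivAt_arcl x)

theorem hasDerivAt_profile (D : TangentData γ p q) (hφ : IsTestFunction a b φ) (w : Plane) (x : ℝ) :
    HasDerivAt (fun y => φ (arcl p y) • w) ((deriv φ (arcl p x) * ‖p x‖) • w) x :=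
  (D.hasDerivAt_comp_arcl hφ x).smul_const w

theorem smul_perturbTan (D : TangentData γ p q) (w : Plane) (t x : ℝ) :
    ‖p x‖ • perturbTan p φ w t x = p x + t • ((deriv φ (arcl p x) * ‖p x‖) • w) := by
  rw [perturbTan, smul_add, D.smul_utan, smul_smul, smul_smul, smul_smul]
  congr 2
  ring

theorem hasDerivWithinAt_perturb (D : TangentData γ p q) (hφ : IsTestFunction a b φ) (w : Plane)
    (t : ℝ) {x : ℝ} (hx : x ∈ Icc (0 : ℝ) 1) :
    HasDerivWithinAt (perturb γ p φ w t) (‖p x‖ • perturbTan p φ w t x) (Icc 0 1) x := by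
  rw [D.smul_perturbTan]
  exact (D.hasDerivWithinAt_curve hx).add
    ((D.hasDerivAt_profile hφ w x).const_smul t).hasDerivWithinAt

theorem hasDerivAt_perturb (D : TangentData γ p q) (hφ : IsTestFunction a b φ) (w : Plane)
    (t : ℝ) {x : ℝ} (hx : x ∈ Ioo (0 : ℝ) 1) :
    HasDerivAt (perturb γ p φ w t) (‖p x‖ • perturbTan p φ w t x) x :=
  (D.hasDerivWithinAt_perturb hφ w t (Ioo_subset_Icc_self hx)).hasDerivAt
    (Icc_mem_nhds hx.1 hx.2)

theorem ae_hasDerivAt_perturbTan (D : TangentData γ p q) (hφ : IsTestFunction a b φ) (w : Plane)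
    (t : ℝ) : ∀ᵐ x, HasDerivAt (perturbTan p φ w t)
      (‖p x‖ • (curv p x + t • (deriv (deriv φ) (arcl p x) • w))) x := by
  filter_upwards [D.ae_hasDerivAt_utan] with x hx
  have h := hx.1.add ((D.hasDerivAt_profile hφ.deriv w x).const_smul t)
  have e : ‖p x‖ • (curv p x + t • (deriv (deriv φ) (arcl p x) • w)) =
      ‖p x‖ • curv p x + t • ((deriv (deriv φ) (arcl p x) * ‖p x‖) • w) := by
    rw [smul_add, smul_comm ‖p x‖ t, smul_smul ‖p x‖, mul_comm]
  rw [e]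
  exact h

theorem half_le_norm_perturbTan (D : TangentData γ p q) {w : Plane} {P t : ℝ}
    (hP : ∀ x, ‖deriv φ x • w‖ ≤ P) (ht : 0 ≤ t) (htP : t * P ≤ 1 / 4) (x : ℝ) :
    1 / 2 ≤ ‖perturbTan p φ w t x‖ := by
  have h1 : ‖utan p x‖ ≤ ‖perturbTan p φ w t x‖ + ‖t • (deriv φ (arcl p x) • w)‖ :=
    norm_le_add_norm_add _ _
  have h2 : ‖t • (deriv φ (arcl p x) • w)‖ ≤ t * P := by
    rw [norm_smul, Real.norm_of_nonneg ht]
    exact mul_le_mul_of_nonneg_left (hP _) ht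
  rw [D.norm_utan] at h1
  linarith

/-- Bound for the bending energy density of a perturbed curve. -/
theorem perturb_density_le (D : TangentData γ p q) (hφ : IsTestFunction a b φ) {w W : Plane}
    {t x : ℝ} (hne : ∀ y, perturbTan p φ w t y ≠ 0) (hx : x ∈ Ioo (0 : ℝ) 1)
    (hW : HasDerivAt (perturbTan p φ w t) (‖p x‖ • W) x) :
    ‖curvatureVector (perturb γ p φ w t) x‖ ^ 2 * ‖deriv (perturb γ p φ w t) x‖ ≤
      ‖W‖ ^ 2 / ‖perturbTan p φ w t x‖ ^ 3 * ‖p x‖ := by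
  set η := perturb γ p φ w t
  set U := perturbTan p φ w t
  have hv := D.norm_pos x
  have hU : 0 < ‖U x‖ := norm_pos_iff.2 (hne x)
  obtain ⟨n', hn, hle⟩ := hasDerivAt_normalize hW (hne x)
  -- The speed of γ cancels: the unit tangent of the varied curve is the normalization of U.
  have heq : arcDeriv η η =ᶠ[𝓝 x] fun y => ‖U y‖⁻¹ • U y := by
    filter_upwards [Ioo_mem_nhds hx.1 hx.2] with y hy
    have hvy := D.norm_pos y
    rw [arcDeriv, (D.hasDerivAt_perturb hφ w t hy).deriv, norm_smul, norm_norm, smul_smul, mul_inv]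
    change (‖p y‖⁻¹ * ‖U y‖⁻¹ * ‖p y‖) • U y = _
    congr 1
    field_simp
  have hd : deriv η x = ‖p x‖ • U x := (D.hasDerivAt_perturb hφ w t hx).deriv
  have hc : curvatureVector η x = (‖p x‖ * ‖U x‖)⁻¹ • n' := by
    rw [curvatureVector, arcDeriv, heq.deriv_eq, hn.deriv, hd, norm_smul, norm_norm]
  rw [norm_smul, norm_norm] at hle
  rw [hc, hd, norm_smul, norm_smul, norm_inv, norm_mul, norm_norm, norm_norm]
  -- Here the part of W along U is discarded, which can only increase the bound.
  have h2 : ‖n'‖ ^ 2 ≤ (‖p x‖ * ‖W‖ / ‖U x‖) ^ 2 := pow_le_pow_left₀ (norm_nonneg _) hle 2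
  calc ((‖p x‖ * ‖U x‖)⁻¹ * ‖n'‖) ^ 2 * (‖p x‖ * ‖U x‖)
      = ‖n'‖ ^ 2 * (‖p x‖ * ‖U x‖)⁻¹ := by field_simp
    _ ≤ (‖p x‖ * ‖W‖ / ‖U x‖) ^ 2 * (‖p x‖ * ‖U x‖)⁻¹ := by gcongr
    _ = ‖W‖ ^ 2 / ‖U x‖ ^ 3 * ‖p x‖ := by field_simp

theorem ae_hasDerivAt_norm (D : TangentData γ p q) :
    ∀ᵐ x, HasDerivAt (fun y => ‖p y‖) (inner ℝ (utan p x) (q x)) x := by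
  filter_upwards [D.ae_hasDerivAt] with x hx
  have hv := D.norm_pos x
  have h := (hx.norm_sq).sqrt (by positivity)
  simp only [Real.sqrt_sq (norm_nonneg _)] at h
  convert h using 1
  rw [utan, inner_smul_left]
  simp only [conj_trivial]
  field_simp

/-- Second derivative of φ(s(x)) w, where s'' = |p|' = ⟨T, q⟩ exists almost everywhere. The first
summand is continuous and the second is bounded by a multiple of ‖q‖. -/
theorem memLp_second_deriv_profile (D : TangentData γ p q) (hφ : IsTestFunction a b φ) (w : Plane) :
    MemLp (fun x => (deriv (deriv φ) (arcl p x) * ‖p x‖ * ‖p x‖ +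
      deriv φ (arcl p x) * inner ℝ (utan p x) (q x)) • w) 2 (volume.restrict (Ioo 0 1)) := by
  have h1 : MemLp (fun x => deriv (deriv φ) (arcl p x) * ‖p x‖ * ‖p x‖) 2
      (volume.restrict (Ioo 0 1)) :=
    memLp_of_continuousOn 2 (((hφ.deriv.deriv.continuous.comp D.continuous_arcl).mul
      D.continuous.norm).mul D.continuous.norm).continuousOn
  obtain ⟨C, hC0, hC⟩ := hφ.deriv.exists_bound
  have h2 : MemLp (fun x => deriv φ (arcl p x) * inner ℝ (utan p x) (q x)) 2
      (volume.restrict (Ioo 0 1)) := by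
    refine MemLp.of_le_mul (c := C) (D.memLp.restrict _) ?_ (Eventually.of_forall fun x => ?_)
    · exact (hφ.deriv.continuous.comp D.continuous_arcl).aestronglyMeasurable.mul
        (D.continuous_utan.aestronglyMeasurable.inner D.memLp.aestronglyMeasurable.restrict)
    · rw [norm_mul]
      have := norm_inner_le_norm (𝕜 := ℝ) (utan p x) (q x)
      rw [D.norm_utan, one_mul] at this
      exact mul_le_mul (hC _) this (norm_nonneg _) hC0
  refine MemLp.of_le_mul (c := ‖w‖) (h1.add h2)
    ((h1.add h2).aestronglyMeasurable.smul aestronglyMeasurable_const)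
    (Eventually.of_forall fun x => ?_)
  rw [norm_smul, mul_comm]
  rfl

theorem ae_hasDerivAt_deriv_profile (D : TangentData γ p q) (hφ : IsTestFunction a b φ)
    (w : Plane) : ∀ᵐ x, HasDerivAt (fun y => (deriv φ (arcl p y) * ‖p y‖) • w)
      ((deriv (deriv φ) (arcl p x) * ‖p x‖ * ‖p x‖ +
        deriv φ (arcl p x) * inner ℝ (utan p x) (q x)) • w) x := by
  filter_upwards [D.ae_hasDerivAt_norm] with x hx
  exact ((D.hasDerivAt_comp_arcl hφ.deriv x).mul hx).smul_const w

theorem contDiff_comp_arcl (D : TangentData γ p q) (hφ : IsTestFunction a b φ) :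
    ContDiff ℝ 1 (fun x => φ (arcl p x)) :=
  (hφ.contDiff.of_le (by simp)).comp D.contDiff_arcl

/-- The reparametrized profile φ ∘ s is only as smooth as the arclength function: C¹ with absolutely
continuous derivative. That is enough for W^{2,2}. -/
theorem isImmersedW22_perturb (D : TangentData γ p q) (hγ : IsImmersedW22 γ)
    (hφ : IsTestFunction a b φ) {w : Plane} {t : ℝ} (hne : ∀ y, perturbTan p φ w t y ≠ 0) :
    IsImmersedW22 (perturb γ p φ w t) := by
  have hC : ContDiffOn ℝ 1 (perturb γ p φ w t) (Icc 0 1) :=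
    hγ.contDiffOn.add (((D.contDiff_comp_arcl hφ).smul contDiff_const).const_smul t).contDiffOn
  have hPC : Continuous fun x => p x + t • ((deriv φ (arcl p x) * ‖p x‖) • w) :=
    D.continuous.add ((((hφ.deriv.continuous.comp D.continuous_arcl).mul
      D.continuous.norm).smul continuous_const).const_smul t)
  have hPac : AbsolutelyContinuousOnInterval
      (fun x => p x + t • ((deriv φ (arcl p x) * ‖p x‖) • w)) 0 1 := by
    refine (D.absolutelyContinuousOnInterval zero_le_one).fun_add
      (AbsolutelyContinuousOnInterval.const_smul t ?_)
    refine AbsolutelyContinuousOnInterval.fun_smul ?_ (absolutelyContinuousOnInterval_const w 0 1)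
    exact (ContDiffOn.absolutelyContinuousOnInterval
      (D.contDiff_comp_arcl hφ.deriv).contDiffOn).fun_mul
      (D.absolutelyContinuousOnInterval_norm zero_le_one)
  refine ⟨hC, ⟨memLp_of_continuousOn 2 hC.continuousOn,
    fun x => p x + t • ((deriv φ (arcl p x) * ‖p x‖) • w), ?_,
    memLp_of_continuousOn 2 hPC.continuousOn,
    fun x => q x + t • ((deriv (deriv φ) (arcl p x) * ‖p x‖ * ‖p x‖ +
        deriv φ (arcl p x) * inner ℝ (utan p x) (q x)) • w), ?_, ?_⟩, fun x hx => ?_⟩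
  · refine hasWeakDeriv_plane_of_absolutelyContinuousOnInterval zero_le_one
      (ContDiffOn.absolutelyContinuousOnInterval (by rwa [uIcc_of_le zero_le_one]))
      (Eventually.of_forall fun x hx => ?_)
    have := D.hasDerivAt_perturb hφ w t hx
    rwa [D.smul_perturbTan] at this
  · refine hasWeakDeriv_plane_of_absolutelyContinuousOnInterval zero_le_one hPac ?_
    filter_upwards [D.ae_hasDerivAt, D.ae_hasDerivAt_deriv_profile hφ w] with x h1 h2 _
    exact h1.add (h2.const_smul t)
  · exact (D.memLp.restrict _).add ((D.memLp_second_deriv_profile hφ w).const_smul t)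
  · rw [(D.hasDerivWithinAt_perturb hφ w t hx).derivWithin (uniqueDiffOn_Icc zero_lt_one x hx)]
    exact smul_ne_zero (D.norm_pos x).ne' (hne x)

theorem w22Norm_profile_ne_top (D : TangentData γ p q) (hφ : IsTestFunction a b φ) (w : Plane) :
    w22Norm (fun x => φ (arcl p x) • w) ≠ ⊤ := by
  have hd : deriv (fun x => φ (arcl p x) • w) = fun x => (deriv φ (arcl p x) * ‖p x‖) • w :=
    funext fun x => (D.hasDerivAt_profile hφ w x).deriv
  have h0 : MemLp (fun x => φ (arcl p x) • w) 2 (volume.restrict (Ioo 0 1)) :=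
    memLp_of_continuousOn 2 ((hφ.continuous.comp D.continuous_arcl).smul
      continuous_const).continuousOn
  have h1 : MemLp (fun x => (deriv φ (arcl p x) * ‖p x‖) • w) 2 (volume.restrict (Ioo 0 1)) :=
    memLp_of_continuousOn 2 (((hφ.deriv.continuous.comp D.continuous_arcl).mul
      D.continuous.norm).smul continuous_const).continuousOn
  have h2 : MemLp (deriv fun x => (deriv φ (arcl p x) * ‖p x‖) • w) 2
      (volume.restrict (Ioo 0 1)) := by
    refine (memLp_congr_ae (ae_restrict_of_ae ?_)).1 (D.memLp_second_deriv_profile hφ w)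
    filter_upwards [D.ae_hasDerivAt_deriv_profile hφ w] with x hx
    exact hx.deriv.symm
  rw [w22Norm, hd]
  exact ENNReal.add_ne_top.2 ⟨ENNReal.add_ne_top.2 ⟨h0.eLpNorm_lt_top.ne, h1.eLpNorm_lt_top.ne⟩,
    h2.eLpNorm_lt_top.ne⟩

theorem w22Norm_const_smul (t : ℝ) (f : ℝ → Plane) : w22Norm (t • f) = ‖t‖ₑ * w22Norm f := by
  have h : ∀ g : ℝ → Plane, deriv (t • g) = t • deriv g := fun g => by
    ext1 x
    exact deriv_const_smul_field t g
  rw [w22Norm, h, h, eLpNorm_const_smul, eLpNorm_const_smul, eLpNorm_const_smul, w22Norm]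
  ring

theorem tendsto_w22Norm_perturb_sub (D : TangentData γ p q) (hφ : IsTestFunction a b φ)
    (w : Plane) : Tendsto (fun t => w22Norm (perturb γ p φ w t - γ)) (𝓝[>] 0) (𝓝 0) := by
  have e : ∀ t, w22Norm (perturb γ p φ w t - γ) = ‖t‖ₑ * w22Norm (fun x => φ (arcl p x) • w) := by
    intro t
    rw [perturb, add_sub_cancel_left, w22Norm_const_smul]
  simp only [e]
  have h1 : Tendsto (fun t : ℝ => ‖t‖ₑ) (𝓝[>] 0) (𝓝 0) := by
    have : Continuous fun t : ℝ => ‖t‖ₑ := continuous_enorm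
    have h := this.tendsto 0
    rw [enorm_zero] at h
    exact h.mono_left nhdsWithin_le_nhds
  have := ENNReal.Tendsto.mul_const h1 (Or.inr (D.w22Norm_profile_ne_top hφ w))
  rwa [zero_mul] at this

end TangentData

/-! ### The first variation of the energy -/

theorem integrableOn_continuous_mul {f g : ℝ → ℝ} {a b : ℝ} (hf : IntegrableOn f (Ioo a b))
    (hg : Continuous g) : IntegrableOn (fun x => g x * f x) (Ioo a b) := by
  rw [← integrableOn_Icc_iff_integrableOn_Ioo] at hf ⊢
  exact hf.continuousOn_mul hg.continuousOn isCompact_Icc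

theorem integral_le_add_mul_add_mul {μ : Measure ℝ} {u f g h : ℝ → ℝ} {r s : ℝ}
    (hu : ∀ x, 0 ≤ u x) (hf : Integrable f μ) (hg : Integrable g μ) (hh : Integrable h μ)
    (hle : ∀ᵐ x ∂μ, u x ≤ f x + r * g x + s * h x) :
    ∫ x, u x ∂μ ≤ (∫ x, f x ∂μ) + r * (∫ x, g x ∂μ) + s * ∫ x, h x ∂μ := by
  have hfg : Integrable (fun x => f x + r * g x) μ := hf.add (hg.const_mul r)
  rw [← integral_const_mul, ← integral_const_mul, ← integral_add hf (hg.const_mul r),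
    ← integral_add hfg (hh.const_mul s)]
  exact integral_mono_of_nonneg (Eventually.of_forall hu) (hfg.add (hh.const_mul s)) hle

/-- Divide by t > 0 and let t tend to 0. -/
theorem nonneg_of_eventually_nonneg_add_sq {I J : ℝ}
    (h : ∀ᶠ t in 𝓝[>] (0 : ℝ), 0 ≤ t * I + t ^ 2 * J) : 0 ≤ I := by
  have hlim : Tendsto (fun t : ℝ => I + t * J) (𝓝[>] 0) (𝓝 I) := by
    have : Continuous fun t : ℝ => I + t * J := by fun_prop
    have h0 := this.tendsto 0
    simp only [zero_mul, add_zero] at h0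
    exact h0.mono_left nhdsWithin_le_nhds
  refine ge_of_tendsto hlim ?_
  filter_upwards [h, self_mem_nhdsWithin] with t ht htpos
  refine le_of_mul_le_mul_left ?_ (show (0 : ℝ) < t from htpos)
  linarith

namespace TangentData

variable {γ p q : ℝ → Plane} {φ : ℝ → ℝ} {a b : ℝ}

theorem integrableOn_curv (D : TangentData γ p q) : IntegrableOn (curv p) (Ioo 0 1) :=
  integrableOn_of_memLp_two D.memLp_curv

/-- Second order upper bound for the energy of the perturbed curves. -/
theorem energy_perturb_le (D : TangentData γ p q) {lam : ℝ} (hlam : 0 ≤ lam)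
    (hφ : IsTestFunction a b φ) (w : Plane) :
    ∃ J, ∀ᶠ t in 𝓝[>] (0 : ℝ), (∀ y, perturbTan p φ w t y ≠ 0) ∧
      energy lam (perturb γ p φ w t) ≤ energy lam γ + t * (∫ x in Ioo (0 : ℝ) 1, ‖p x‖ *
        (deriv (deriv φ) (arcl p x) * (2 * inner ℝ (curv p x) w) +
          deriv φ (arcl p x) * ((lam - 3 * ‖curv p x‖ ^ 2) * inner ℝ (utan p x) w))) + t ^ 2 * J := by
  obtain ⟨C1, hC10, hC1⟩ := hφ.deriv.exists_bound
  obtain ⟨C2, hC20, hC2⟩ := hφ.deriv.deriv.exists_bound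
  set P := max (C1 * ‖w‖) (C2 * ‖w‖)
  have ha : ∀ y, ‖deriv φ y • w‖ ≤ P := fun y => by
    rw [norm_smul]
    exact (mul_le_mul_of_nonneg_right (hC1 y) (norm_nonneg w)).trans (le_max_left _ _)
  have hb : ∀ y, ‖deriv (deriv φ) y • w‖ ≤ P := fun y => by
    rw [norm_smul]
    exact (mul_le_mul_of_nonneg_right (hC2 y) (norm_nonneg w)).trans (le_max_right _ _)
  have c1 : Continuous fun x => deriv φ (arcl p x) := hφ.deriv.continuous.comp D.continuous_arcl
  have c2 : Continuous fun x => deriv (deriv φ) (arcl p x) :=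
    hφ.deriv.deriv.continuous.comp D.continuous_arcl
  have cT : Continuous fun x => (inner ℝ (utan p x) w : ℝ) := D.continuous_utan.inner continuous_const
  have hv : Continuous fun x => ‖p x‖ := D.continuous.norm
  have i1 : IntegrableOn (fun x => ‖p x‖ * ‖curv p x‖ ^ 2) (Ioo 0 1) :=
    integrableOn_continuous_mul D.integrableOn_sq_curv hv
  have ik : IntegrableOn (fun x => (inner ℝ (curv p x) w : ℝ)) (Ioo 0 1) :=
    Integrable.inner_const D.integrableOn_curv w
  have i2 : IntegrableOn (fun x => ‖p x‖ * (deriv (deriv φ) (arcl p x) *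
      (2 * inner ℝ (curv p x) w) - 3 * ‖curv p x‖ ^ 2 * (deriv φ (arcl p x) *
        inner ℝ (utan p x) w))) (Ioo 0 1) := by
    have j1 := integrableOn_continuous_mul (ik.const_mul 2) (hv.mul c2)
    have j2 := integrableOn_continuous_mul (D.integrableOn_sq_curv.const_mul 3)
      (hv.mul (c1.mul cT))
    refine (j1.sub j2).congr (Eventually.of_forall fun x => ?_)
    simp only [Pi.sub_apply, Pi.mul_apply]
    ring
  have iv : IntegrableOn (fun x => ‖p x‖) (Ioo 0 1) :=
    (hv.continuousOn.integrableOn_compact isCompact_Icc).mono_set Ioo_subset_Icc_self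
  have i3 : IntegrableOn (fun x => ‖p x‖ * (500 * P ^ 2 * (1 + ‖curv p x‖ ^ 2))) (Ioo 0 1) := by
    refine ((iv.add i1).const_mul (500 * P ^ 2)).congr (Eventually.of_forall fun x => ?_)
    simp only [Pi.add_apply]
    ring
  have i5 : IntegrableOn (fun x => ‖p x‖ * (deriv φ (arcl p x) * inner ℝ (utan p x) w))
      (Ioo 0 1) :=
    ((hv.mul (c1.mul cT)).continuousOn.integrableOn_compact isCompact_Icc).mono_set
      Ioo_subset_Icc_self
  have i6 : IntegrableOn (fun x => ‖p x‖ * (P ^ 2 / 2)) (Ioo 0 1) := iv.mul_const _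
  refine ⟨(∫ x in Ioo (0 : ℝ) 1, ‖p x‖ * (500 * P ^ 2 * (1 + ‖curv p x‖ ^ 2))) +
    lam * ∫ x in Ioo (0 : ℝ) 1, ‖p x‖ * (P ^ 2 / 2), ?_⟩
  have hsmall : ∀ᶠ t in 𝓝[>] (0 : ℝ), t * P ≤ 1 / 4 := by
    have : Continuous fun t : ℝ => t * P := by fun_prop
    have h0 := this.tendsto 0
    rw [zero_mul] at h0
    exact (h0.mono_left nhdsWithin_le_nhds).eventually (ge_mem_nhds (by norm_num))
  filter_upwards [hsmall, self_mem_nhdsWithin] with t htP htpos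
  have ht : 0 ≤ t := le_of_lt htpos
  have hne : ∀ y, perturbTan p φ w t y ≠ 0 := fun y => by
    have := D.half_le_norm_perturbTan ha ht htP y
    exact norm_pos_iff.1 (by linarith)
  refine ⟨hne, ?_⟩
  set η := perturb γ p φ w t
  have hbend : bendingEnergy η ≤ (∫ x in Ioo (0 : ℝ) 1, ‖p x‖ * ‖curv p x‖ ^ 2) +
      t * (∫ x in Ioo (0 : ℝ) 1, ‖p x‖ * (deriv (deriv φ) (arcl p x) *
      (2 * inner ℝ (curv p x) w) - 3 * ‖curv p x‖ ^ 2 * (deriv φ (arcl p x) *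
        inner ℝ (utan p x) w))) +
      t ^ 2 * ∫ x in Ioo (0 : ℝ) 1, ‖p x‖ * (500 * P ^ 2 * (1 + ‖curv p x‖ ^ 2)) := by
    rw [bendingEnergy, intervalIntegral.integral_of_le zero_le_one, integral_Ioc_eq_integral_Ioo]
    refine integral_le_add_mul_add_mul (fun x => by positivity) i1 i2 i3 ?_
    rw [ae_restrict_iff' measurableSet_Ioo]
    filter_upwards [D.ae_hasDerivAt_perturbTan hφ w t] with x hx hxm
    refine (D.perturb_density_le hφ hne hxm hx).trans ?_
    have hbd := bending_density_le (k := curv p x) (D.norm_utan x) (ha (arcl p x))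
      (hb (arcl p x)) ht htP
    refine (mul_le_mul_of_nonneg_right hbd (norm_nonneg (p x))).trans (le_of_eq ?_)
    rw [inner_smul_right, inner_smul_right]
    ring
  have hlen : curveLength η ≤ (∫ x in Ioo (0 : ℝ) 1, ‖p x‖) +
      t * (∫ x in Ioo (0 : ℝ) 1, ‖p x‖ * (deriv φ (arcl p x) * inner ℝ (utan p x) w)) +
      t ^ 2 * ∫ x in Ioo (0 : ℝ) 1, ‖p x‖ * (P ^ 2 / 2) := by
    rw [curveLength, arclength, intervalIntegral.integral_of_le zero_le_one,
      integral_Ioc_eq_integral_Ioo]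
    refine integral_le_add_mul_add_mul (fun x => by positivity) iv i5 i6 ?_
    rw [ae_restrict_iff' measurableSet_Ioo]
    refine Eventually.of_forall fun x hxm => ?_
    rw [(D.hasDerivAt_perturb hφ w t hxm).deriv, norm_smul, norm_norm]
    have hl := norm_add_smul_le_of_norm_eq_one (t := t) (D.norm_utan x) (ha (arcl p x))
    refine (mul_le_mul_of_nonneg_left hl (norm_nonneg (p x))).trans (le_of_eq ?_)
    rw [inner_smul_right]
    ring
  have hsplit : (∫ x in Ioo (0 : ℝ) 1, ‖p x‖ *
        (deriv (deriv φ) (arcl p x) * (2 * inner ℝ (curv p x) w) +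
          deriv φ (arcl p x) * ((lam - 3 * ‖curv p x‖ ^ 2) * inner ℝ (utan p x) w))) =
      (∫ x in Ioo (0 : ℝ) 1, ‖p x‖ * (deriv (deriv φ) (arcl p x) *
      (2 * inner ℝ (curv p x) w) - 3 * ‖curv p x‖ ^ 2 * (deriv φ (arcl p x) *
        inner ℝ (utan p x) w))) +
      lam * ∫ x in Ioo (0 : ℝ) 1, ‖p x‖ * (deriv φ (arcl p x) * inner ℝ (utan p x) w) := by
    rw [← integral_const_mul, ← integral_add i2 (i5.const_mul lam)]
    congr 1
    ext x
    ring
  have hγE : energy lam γ = (∫ x in Ioo (0 : ℝ) 1, ‖p x‖ * ‖curv p x‖ ^ 2) +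
      lam * ∫ x in Ioo (0 : ℝ) 1, ‖p x‖ := by
    rw [energy, D.bendingEnergy_eq, D.curveLength_eq]
    simp only [mul_comm]
  rw [hsplit, hγE, energy]
  have := mul_le_mul_of_nonneg_left hlen hlam
  linarith

/-- The variational inequality for admissible perturbations in a fixed direction. -/
theorem first_variation_nonneg (D : TangentData γ p q) {lam : ℝ} {ψ : ℝ → ℝ} (hlam : 0 ≤ lam)
    (hγ : IsLocalMinimizer lam ψ γ) (hφ : IsTestFunction 0 (arcl p 1) φ) (w : Plane)
    (hadm : ∀ᶠ t in 𝓝[>] (0 : ℝ), ∀ x ∈ Icc (0 : ℝ) 1,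
      ψ (perturb γ p φ w t x 0) ≤ perturb γ p φ w t x 1) :
    0 ≤ ∫ x in Ioo (0 : ℝ) 1, ‖p x‖ *
        (deriv (deriv φ) (arcl p x) * (2 * inner ℝ (curv p x) w) +
          deriv φ (arcl p x) * ((lam - 3 * ‖curv p x‖ ^ 2) * inner ℝ (utan p x) w)) := by
  obtain ⟨⟨himm, h0, h1, -⟩, ε, hε, hmin⟩ := hγ
  obtain ⟨J, hJ⟩ := D.energy_perturb_le hlam hφ w
  refine nonneg_of_eventually_nonneg_add_sq (J := J) ?_
  filter_upwards [hJ, hadm, (D.tendsto_w22Norm_perturb_sub hφ w).eventually (gt_mem_nhds hε)]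
    with t ht htadm htε
  -- The profile is supported inside (0, L), so the boundary points do not move.
  have hend : ∀ x, arcl p x ∉ Ioo 0 (arcl p 1) → perturb γ p φ w t x = γ x := by
    intro x hx
    simp [perturb, hφ.eq_zero hx]
  have := hmin _ ⟨D.isImmersedW22_perturb himm hφ ht.1,
    by rw [hend 0 (by simp [arcl_zero]), h0], by rw [hend 1 (by simp), h1], htadm⟩ htε
  linarith [ht.2]

end TangentData

/-! ### Sobolev regularity of Lipschitz functions -/

theorem MemSobolev.congr {E : Type*} [NormedAddCommGroup E] [NormedSpace ℝ E] {m : ℕ} {r : ℝ≥0∞}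
    {a b : ℝ} {f g : ℝ → E} (hf : MemSobolev m r a b f) (h : EqOn f g (Ioo a b)) :
    MemSobolev m r a b g := by
  have hae : f =ᵐ[volume.restrict (Ioo a b)] g := by
    rw [EventuallyEq, ae_restrict_iff' measurableSet_Ioo]
    exact Eventually.of_forall h
  cases m with
  | zero => exact (memLp_congr_ae hae).1 hf
  | succ m =>
    obtain ⟨h1, k, ⟨hw1, hw2, hw3⟩, hk⟩ := hf
    refine ⟨(memLp_congr_ae hae).1 h1, k, ⟨?_, hw2, fun φ p1 p2 p3 => ?_⟩, hk⟩
    · intro x hx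
      obtain ⟨s, hs, hi⟩ := hw1 x hx
      refine ⟨s ∩ Ioo a b, inter_mem hs self_mem_nhdsWithin, ?_⟩
      have hi' : Integrable f (volume.restrict (s ∩ Ioo a b)) := hi.mono_set inter_subset_left
      refine hi'.congr (ae_restrict_of_ae_restrict_of_subset inter_subset_right hae)
    · rw [← hw3 φ p1 p2 p3]
      refine setIntegral_congr_fun measurableSet_Ioo fun x hx => ?_
      rw [h hx]

theorem memLp_top_deriv_of_lipschitzWith {E : Type*} [NormedAddCommGroup E] [NormedSpace ℝ E]
    [CompleteSpace E] [SecondCountableTopology E] {K : ℝ≥0} {f : ℝ → E} (hf : LipschitzWith K f)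
    (a b : ℝ) : MemLp (deriv f) ⊤ (volume.restrict (Ioo a b)) :=
  MemLp.of_bound (stronglyMeasurable_deriv f).aestronglyMeasurable K
    (Eventually.of_forall fun _ => norm_deriv_le_of_lipschitz hf)

theorem memSobolev_one_top_of_lipschitzWith {K : ℝ≥0} {f : ℝ → ℝ} {a b : ℝ} (hab : a ≤ b)
    (hf : LipschitzWith K f) : MemSobolev 1 ⊤ a b f := by
  refine ⟨memLp_of_continuousOn ⊤ hf.continuous.continuousOn, deriv f,
    hasWeakDeriv_of_absolutelyContinuousOnInterval hab
      hf.lipschitzOnWith.absolutelyContinuousOnInterval ?_, memLp_top_deriv_of_lipschitzWith hf a b⟩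
  filter_upwards [hf.ae_differentiableAt_real] with x hx _
  exact hx.hasDerivAt

theorem memSobolev_one_top_plane_of_lipschitzWith {K : ℝ≥0} {f : ℝ → Plane} {a b : ℝ}
    (hab : a ≤ b) (hf : LipschitzWith K f) : MemSobolev 1 ⊤ a b f := by
  refine ⟨memLp_of_continuousOn ⊤ hf.continuous.continuousOn, deriv f,
    hasWeakDeriv_plane_of_absolutelyContinuousOnInterval hab
      hf.lipschitzOnWith.absolutelyContinuousOnInterval ?_, memLp_top_deriv_of_lipschitzWith hf a b⟩
  filter_upwards [hf.ae_differentiableAt_real] with x hx _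
  exact hx.hasDerivAt

theorem MemSobolev.of_hasDerivAt {m : ℕ} {f g : ℝ → Plane} {a b : ℝ} (hab : a ≤ b)
    (h : ∀ x, HasDerivAt f (g x) x) (hgc : Continuous g) (hg : MemSobolev m ⊤ a b g) :
    MemSobolev (m + 1) ⊤ a b f := by
  have hd : deriv f = g := funext fun x => (h x).deriv
  have hC : ContDiff ℝ 1 f := contDiff_one_iff_deriv.2
    ⟨fun x => (h x).differentiableAt, by rwa [hd]⟩
  exact ⟨memLp_of_continuousOn ⊤ hC.continuous.continuousOn, g,
    hasWeakDeriv_plane_of_absolutelyContinuousOnInterval hab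
      (ContDiffOn.absolutelyContinuousOnInterval hC.contDiffOn)
      (Eventually.of_forall fun x _ => h x), hg⟩

/-! ### Admissible perturbations -/

namespace TangentData

variable {γ p q : ℝ → Plane} {φ : ℝ → ℝ}

theorem perturb_apply (γ p : ℝ → Plane) (φ : ℝ → ℝ) (w : Plane) (t x : ℝ) (i : Fin 2) :
    perturb γ p φ w t x i = γ x i + t * (φ (arcl p x) * w i) := by
  simp [perturb]

/-- The variation raises γ² by t φ w¹ and changes ψ(γ¹) by at most K t φ |w⁰| (coordinates numbered
from 0). In this cone of directions the gain dominates for every t > 0, whether or not the curve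
touches the obstacle. -/
theorem admissible_of_nonneg {ψ : ℝ → ℝ} {K : ℝ≥0} (hψ : LipschitzWith K ψ)
    (hγ : ∀ x ∈ Icc (0 : ℝ) 1, ψ (γ x 0) ≤ γ x 1) (hφ : ∀ u, 0 ≤ φ u) {w : Plane}
    (hw : K * |w 0| ≤ w 1) : ∀ᶠ t in 𝓝[>] (0 : ℝ), ∀ x ∈ Icc (0 : ℝ) 1,
      ψ (perturb γ p φ w t x 0) ≤ perturb γ p φ w t x 1 := by
  filter_upwards [self_mem_nhdsWithin] with t ht x hx
  have ht0 : 0 ≤ t := le_of_lt ht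
  rw [perturb_apply, perturb_apply]
  have h1 := (le_abs_self _).trans (hψ.dist_le_mul (γ x 0 + t * (φ (arcl p x) * w 0)) (γ x 0))
  rw [Real.dist_eq, add_sub_cancel_left, abs_mul, abs_mul, abs_of_nonneg ht0,
    abs_of_nonneg (hφ _)] at h1
  have h2 := mul_le_mul_of_nonneg_left hw (mul_nonneg ht0 (hφ (arcl p x)))
  have h3 := hγ x hx
  linarith

/-- By compactness the gap between curve and obstacle on [c, d] is at least some μ > 0, while the
variation costs at most t C (K |w 0| + |w 1|). Neither the sign of φ nor the direction w is
restricted, so the first variation vanishes for such φ. -/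
theorem admissible_of_slack {ψ : ℝ → ℝ} {K : ℝ≥0} (hψ : LipschitzWith K ψ)
    (hγc : ContinuousOn γ (Icc 0 1)) (hγ : ∀ x ∈ Icc (0 : ℝ) 1, ψ (γ x 0) ≤ γ x 1)
    {a b : ℝ} (hφ : IsTestFunction a b φ) (w : Plane) {c d : ℝ} (hcd : Icc c d ⊆ Icc 0 1)
    (hslack : ∀ x ∈ Icc c d, ψ (γ x 0) < γ x 1)
    (hsupp : ∀ x ∈ Icc (0 : ℝ) 1, φ (arcl p x) ≠ 0 → x ∈ Icc c d) :
    ∀ᶠ t in 𝓝[>] (0 : ℝ), ∀ x ∈ Icc (0 : ℝ) 1,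
      ψ (perturb γ p φ w t x 0) ≤ perturb γ p φ w t x 1 := by
  obtain ⟨μ, hμ, hmin⟩ : ∃ μ, 0 < μ ∧ ∀ x ∈ Icc c d, μ ≤ γ x 1 - ψ (γ x 0) := by
    rcases (Icc c d).eq_empty_or_nonempty with he | hne
    · exact ⟨1, one_pos, by simp [he]⟩
    · have hi (i : Fin 2) : ContinuousOn (fun x => γ x i) (Icc c d) :=
        (EuclideanSpace.proj (𝕜 := ℝ) i).continuous.comp_continuousOn (hγc.mono hcd)
      obtain ⟨x0, hx0, hm⟩ := isCompact_Icc.exists_isMinOn hne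
        ((hi 1).sub (hψ.continuous.comp_continuousOn (hi 0)))
      exact ⟨_, sub_pos.2 (hslack x0 hx0), fun x hx => hm hx⟩
  obtain ⟨C, hC0, hC⟩ := hφ.exists_bound
  have hsmall : ∀ᶠ t in 𝓝[>] (0 : ℝ), t * (C * (K * |w 0| + |w 1|)) ≤ μ := by
    have : Continuous fun t : ℝ => t * (C * (K * |w 0| + |w 1|)) := by fun_prop
    have h0 := this.tendsto 0
    rw [zero_mul] at h0
    exact (h0.mono_left nhdsWithin_le_nhds).eventually (ge_mem_nhds hμ)
  filter_upwards [self_mem_nhdsWithin, hsmall] with t ht htμ x hx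
  have ht0 : 0 ≤ t := le_of_lt ht
  rw [perturb_apply, perturb_apply]
  by_cases hz : φ (arcl p x) = 0
  · simpa [hz] using hγ x hx
  · have h1 := (le_abs_self _).trans (hψ.dist_le_mul (γ x 0 + t * (φ (arcl p x) * w 0)) (γ x 0))
    rw [Real.dist_eq, add_sub_cancel_left, abs_mul, abs_mul, abs_of_nonneg ht0] at h1
    have h2 := hmin x (hsupp x hx hz)
    have h3 : -(t * (|φ (arcl p x)| * |w 1|)) ≤ t * (φ (arcl p x) * w 1) := by
      rw [← abs_mul, ← mul_neg]
      exact mul_le_mul_of_nonneg_left (neg_abs_le _) ht0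
    have h4 : t * (|φ (arcl p x)| * (K * |w 0| + |w 1|)) ≤ t * (C * (K * |w 0| + |w 1|)) := by
      gcongr
      exact hC _
    linarith

/-! ### Change of variables to arclength -/

theorem image_arcl_Ioo (D : TangentData γ p q) {x : ℝ} (hx : 0 ≤ x) :
    arcl p '' Ioo 0 x = Ioo 0 (arcl p x) := by
  apply Subset.antisymm
  · rintro _ ⟨y, hy, rfl⟩
    refine ⟨?_, D.strictMono_arcl hy.2⟩
    have := D.strictMono_arcl hy.1
    rwa [arcl_zero] at this
  · have := intermediate_value_Ioo hx D.continuous_arcl.continuousOn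
    rwa [arcl_zero] at this

theorem setIntegral_arcl {F : Type*} [NormedAddCommGroup F] [NormedSpace ℝ F]
    (D : TangentData γ p q) {x : ℝ} (hx : 0 ≤ x) (g : ℝ → F) :
    ∫ u in Ioo 0 (arcl p x), g u = ∫ y in Ioo 0 x, ‖p y‖ • g (arcl p y) := by
  rw [← D.image_arcl_Ioo hx, integral_image_eq_integral_abs_deriv_smul measurableSet_Ioo
    (fun y _ => (D.hasDerivAt_arcl y).hasDerivWithinAt) D.strictMono_arcl.injective.injOn]
  simp only [abs_norm]

theorem integrableOn_arcl_iff {F : Type*} [NormedAddCommGroup F] [NormedSpace ℝ F]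
    (D : TangentData γ p q) {x : ℝ} (hx : 0 ≤ x) (g : ℝ → F) :
    IntegrableOn g (Ioo 0 (arcl p x)) ↔
      IntegrableOn (fun y => ‖p y‖ • g (arcl p y)) (Ioo 0 x) := by
  rw [← D.image_arcl_Ioo hx, integrableOn_image_iff_integrableOn_abs_deriv_smul measurableSet_Ioo
    (fun y _ => (D.hasDerivAt_arcl y).hasDerivWithinAt) D.strictMono_arcl.injective.injOn]
  simp only [abs_norm]

theorem invFunOn_arclength (D : TangentData γ p q) {x : ℝ} (hx : x ∈ Icc (0 : ℝ) 1) :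
    Function.invFunOn (arclength γ) (Icc 0 1) (arcl p x) = x := by
  have hex : ∃ y ∈ Icc (0 : ℝ) 1, arclength γ y = arcl p x := ⟨x, hx, D.arclength_eq hx⟩
  have hm := Function.invFunOn_mem hex
  have he := Function.invFunOn_eq hex
  rw [D.arclength_eq hm] at he
  exact D.strictMono_arcl.injective he

end TangentData

/-! ### Regularity of the curvature -/

/-- The integrand is controlled on (0, L) only, so the primitive is Lipschitz on [0, L] and is then
extended to the line. -/
theorem exists_lipschitzWith_eqOn_primitive {g : ℝ → ℝ} {L C : ℝ} (hL : 0 ≤ L)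
    (hg : IntegrableOn g (Ioo 0 L)) (hC : ∀ᵐ u, u ∈ Ioo 0 L → |g u| ≤ C) :
    ∃ (K : ℝ≥0) (G : ℝ → ℝ), LipschitzWith K G ∧
      EqOn (fun u => ∫ t in (0 : ℝ)..u, g t) G (Icc 0 L) := by
  have hgi : IntervalIntegrable g volume 0 L :=
    (intervalIntegrable_iff_integrableOn_Ioo_of_le hL).2 hg
  have hlip : LipschitzOnWith (Real.toNNReal C) (fun u => ∫ t in (0 : ℝ)..u, g t) (Icc 0 L) := by
    refine LipschitzOnWith.of_dist_le_mul fun x hx y hy => ?_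
    have hsub : ∀ z ∈ Icc 0 L, IntervalIntegrable g volume 0 z := fun z hz =>
      hgi.mono_set (uIcc_subset_uIcc_left (Icc_subset_uIcc hz))
    rw [Real.dist_eq, Real.dist_eq x y,
      intervalIntegral.integral_interval_sub_left (hsub x hx) (hsub y hy), ← Real.norm_eq_abs]
    refine intervalIntegral.norm_integral_le_of_norm_le_const_ae ?_
    have h1 : ∀ᵐ t : ℝ, t ≠ L := by simp [ae_iff, measure_singleton]
    filter_upwards [hC, h1] with t ht htL htm
    rw [mem_uIoc] at htm
    refine (ht ?_).trans (Real.le_coe_toNNReal C)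
    rcases htm with h | h
    · exact ⟨by linarith [hy.1, h.1], lt_of_le_of_ne (by linarith [hx.2, h.2]) htL⟩
    · exact ⟨by linarith [hx.1, h.1], lt_of_le_of_ne (by linarith [hy.2, h.2]) htL⟩
  obtain ⟨G, hG, hGe⟩ := hlip.extend_real
  exact ⟨_, G, hG, hGe⟩

theorem lipschitzWith_smul_const {K : ℝ≥0} {h : ℝ → ℝ} (hh : LipschitzWith K h) (v : Plane) :
    LipschitzWith (K * ‖v‖₊) fun u => h u • v := by
  refine LipschitzWith.of_dist_le_mul fun x y => ?_
  have := hh.dist_le_mul x y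
  rw [dist_eq_norm, ← sub_smul, norm_smul, NNReal.coe_mul, coe_nnnorm, mul_right_comm]
  gcongr
  rwa [← dist_eq_norm]

/-- A square integrable curvature solving the Euler-Lagrange inequality of the elastic energy in the directions
`(±1, M)`, with equality near the endpoints, is almost everywhere equal to a Lipschitz function. -/
theorem exists_lipschitzWith_of_inequality {κ T : ℝ → Plane} {L M lam c d : ℝ} (hM : 0 < M)
    (hc0 : 0 < c) (hcL : c < L) (hd0 : 0 < d) (hdL : d < L) (hT : ∀ u ∈ Ioo 0 L, ‖T u‖ = 1)
    (hκ : IntegrableOn κ (Ioo 0 L))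
    (hg : ∀ w : Plane, IntegrableOn (fun u => (lam - 3 * ‖κ u‖ ^ 2) * inner ℝ (T u) w) (Ioo 0 L))
    (h : ∀ w : Plane, M * |w 0| ≤ w 1 → ∀ φ, IsTestFunction 0 L φ → (∀ t, 0 ≤ φ t) →
      0 ≤ ∫ u in Ioo 0 L, (deriv (deriv φ) u * (2 * inner ℝ (κ u) w) +
        deriv φ u * ((lam - 3 * ‖κ u‖ ^ 2) * inner ℝ (T u) w)))
    (hl : ∀ w : Plane, ∀ φ, IsTestFunction 0 c φ →
      0 ≤ ∫ u in Ioo 0 L, (deriv (deriv φ) u * (2 * inner ℝ (κ u) w) +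
        deriv φ u * ((lam - 3 * ‖κ u‖ ^ 2) * inner ℝ (T u) w)))
    (hr : ∀ w : Plane, ∀ φ, IsTestFunction d L φ →
      0 ≤ ∫ u in Ioo 0 L, (deriv (deriv φ) u * (2 * inner ℝ (κ u) w) +
        deriv φ u * ((lam - 3 * ‖κ u‖ ^ 2) * inner ℝ (T u) w))) :
    ∃ (K : ℝ≥0) (Λ : ℝ → Plane), LipschitzWith K Λ ∧ ∀ᵐ u, u ∈ Ioo 0 L → κ u = Λ u := by
  have hL : 0 < L := hc0.trans hcL
  have hreg : ∀ w : Plane, M * |w 0| ≤ w 1 → ∃ (K : ℝ≥0) (k : ℝ → ℝ), LipschitzWith K k ∧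
      ∀ᵐ u, u ∈ Ioo 0 L → 2 * inner ℝ (κ u) w =
        k u + ∫ t in (0 : ℝ)..u, (lam - 3 * ‖κ t‖ ^ 2) * inner ℝ (T t) w := fun w hw =>
    exists_lipschitzWith_ae_eq_sub hc0 hcL hd0 hdL ((Integrable.inner_const hκ w).const_mul 2)
      (hg w) (h w hw) (hl w) (hr w)
  -- First round of the bootstrap: a Lipschitz function plus a primitive of an integrable function
  -- is continuous, hence bounded on [0, L].
  have hbound : ∀ w : Plane, M * |w 0| ≤ w 1 →
      ∃ C, ∀ᵐ u, u ∈ Ioo 0 L → |inner ℝ (κ u) w| ≤ C := by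
    intro w hw
    obtain ⟨K, k, hk, hke⟩ := hreg w hw
    have hgi : IntervalIntegrable (fun t => (lam - 3 * ‖κ t‖ ^ 2) * inner ℝ (T t) w) volume 0 L :=
      (intervalIntegrable_iff_integrableOn_Ioo_of_le hL.le).2 (hg w)
    have hcont := (hgi.absolutelyContinuousOnInterval_intervalIntegral (c := 0)
      left_mem_uIcc).continuousOn
    rw [uIcc_of_le hL.le] at hcont
    obtain ⟨C, hC⟩ := isCompact_Icc.exists_bound_of_continuousOn
      (hk.continuous.continuousOn.add hcont)
    refine ⟨C, ?_⟩
    filter_upwards [hke] with u hu hum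
    have h1 := hC u (Ioo_subset_Icc_self hum)
    rw [Pi.add_apply, ← hu hum, Real.norm_eq_abs, abs_mul, abs_two] at h1
    linarith [abs_nonneg (inner ℝ (κ u) w : ℝ)]
  set w1 : Plane := !₂[1, M] with hw1
  set w2 : Plane := !₂[-1, M] with hw2
  -- `A1`, `A2` is the dual basis of `w1`, `w2`, the generators of the cone of admissible
  -- directions; it exists because M ≠ 0.
  set A1 : Plane := !₂[1 / 2, 1 / (2 * M)] with hA1
  set A2 : Plane := !₂[-(1 / 2), 1 / (2 * M)] with hA2
  have hdecomp : ∀ v : Plane, v = (inner ℝ v w1 : ℝ) • A1 + (inner ℝ v w2 : ℝ) • A2 := by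
    intro v
    ext i
    fin_cases i
    · simp [hw1, hw2, hA1, hA2, PiLp.inner_apply, Fin.sum_univ_two]
      ring
    · simp [hw1, hw2, hA1, hA2, PiLp.inner_apply, Fin.sum_univ_two]
      field_simp
      ring
  have hc1 : M * |w1 0| ≤ w1 1 := by simp [hw1]
  have hc2 : M * |w2 0| ≤ w2 1 := by simp [hw2]
  obtain ⟨C1, hC1⟩ := hbound w1 hc1
  obtain ⟨C2, hC2⟩ := hbound w2 hc2
  have hκb : ∀ᵐ u, u ∈ Ioo 0 L → ‖κ u‖ ≤ C1 * ‖A1‖ + C2 * ‖A2‖ := by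
    filter_upwards [hC1, hC2] with u h1 h2 hu
    rw [hdecomp (κ u)]
    refine (norm_add_le _ _).trans ?_
    rw [norm_smul, norm_smul, Real.norm_eq_abs, Real.norm_eq_abs]
    gcongr
    · exact h1 hu
    · exact h2 hu
  have hgb : ∀ w : Plane, ∀ᵐ u, u ∈ Ioo 0 L → |(lam - 3 * ‖κ u‖ ^ 2) * inner ℝ (T u) w| ≤
      (|lam| + 3 * (C1 * ‖A1‖ + C2 * ‖A2‖) ^ 2) * ‖w‖ := by
    intro w
    filter_upwards [hκb] with u hu hum
    rw [abs_mul]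
    have h1 : |lam - 3 * ‖κ u‖ ^ 2| ≤ |lam| + 3 * (C1 * ‖A1‖ + C2 * ‖A2‖) ^ 2 := by
      refine (abs_sub _ _).trans ?_
      rw [abs_of_nonneg (by positivity : (0 : ℝ) ≤ 3 * ‖κ u‖ ^ 2)]
      have := pow_le_pow_left₀ (norm_nonneg _) (hu hum) 2
      linarith
    have h2 : |inner ℝ (T u) w| ≤ ‖w‖ := by
      have := abs_real_inner_le_norm (T u) w
      rwa [hT u hum, one_mul] at this
    exact mul_le_mul h1 h2 (abs_nonneg _) ((abs_nonneg _).trans h1)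
  -- Second round: with κ bounded the integrand is bounded, so its primitive is Lipschitz too.
  have hlip : ∀ w : Plane, M * |w 0| ≤ w 1 → ∃ (K : ℝ≥0) (k : ℝ → ℝ), LipschitzWith K k ∧
      ∀ᵐ u, u ∈ Ioo 0 L → 2 * inner ℝ (κ u) w = k u := by
    intro w hw
    obtain ⟨K, k, hk, hke⟩ := hreg w hw
    obtain ⟨K', G, hG, hGe⟩ := exists_lipschitzWith_eqOn_primitive hL.le (hg w) (hgb w)
    refine ⟨K + K', fun u => k u + G u, hk.add hG, ?_⟩
    filter_upwards [hke] with u hu hum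
    rw [hu hum, ← hGe (Ioo_subset_Icc_self hum)]
  obtain ⟨K1, k1, hk1, he1⟩ := hlip w1 hc1
  obtain ⟨K2, k2, hk2, he2⟩ := hlip w2 hc2
  refine ⟨_, fun u => k1 u • ((1 / 2 : ℝ) • A1) + k2 u • ((1 / 2 : ℝ) • A2),
    (lipschitzWith_smul_const hk1 _).add (lipschitzWith_smul_const hk2 _), ?_⟩
  filter_upwards [he1, he2] with u h1 h2 hu
  rw [hdecomp (κ u), ← h1 hu, ← h2 hu, smul_smul, smul_smul]
  congr 2 <;> ring

namespace TangentData

variable {γ p q : ℝ → Plane}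

/-- At the endpoints γ² = 0 while ψ(0) and ψ(1) are negative; strictness persists nearby by
continuity. This is the only place where the signs of ψ enter. -/
theorem exists_slack {ψ : ℝ → ℝ} (hψ : IsObstacle ψ)
    (hγ : γ ∈ admissible ψ) : ∃ c ∈ Ioo (0 : ℝ) 1, ∃ d ∈ Ioo (0 : ℝ) 1,
      (∀ x ∈ Icc 0 c, ψ (γ x 0) < γ x 1) ∧ ∀ x ∈ Icc d 1, ψ (γ x 0) < γ x 1 := by
  have hγc : ContinuousOn γ (Icc 0 1) := hγ.1.contDiffOn.continuousOn
  have hi (i : Fin 2) : ContinuousOn (fun x => γ x i) (Icc 0 1) :=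
    (EuclideanSpace.proj (𝕜 := ℝ) i).continuous.comp_continuousOn hγc
  have hm : ContinuousOn (fun x => γ x 1 - ψ (γ x 0)) (Icc 0 1) :=
    (hi 1).sub (hψ.uniformContinuous.continuous.comp_continuousOn (hi 0))
  have h0 : ∀ᶠ x in 𝓝[Icc 0 1] (0 : ℝ), 0 < γ x 1 - ψ (γ x 0) := by
    refine (hm 0 (by simp)).eventually (lt_mem_nhds ?_)
    have := hψ.neg_left 0 le_rfl
    simp [hγ.2.1, this]
  have h1 : ∀ᶠ x in 𝓝[Icc 0 1] (1 : ℝ), 0 < γ x 1 - ψ (γ x 0) := by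
    refine (hm 1 (by simp)).eventually (lt_mem_nhds ?_)
    have := hψ.neg_right 1 le_rfl
    simp [hγ.2.2.1, this]
  rw [Filter.Eventually, Metric.mem_nhdsWithin_iff] at h0 h1
  obtain ⟨r, hr, h0⟩ := h0
  obtain ⟨s, hs, h1⟩ := h1
  have hr' : 0 < min (r / 2) (1 / 2) := by positivity
  have hs' : 0 < min (s / 2) (1 / 2) := by positivity
  refine ⟨min (r / 2) (1 / 2), ⟨hr', by linarith [min_le_right (r / 2) (1 / 2)]⟩,
    1 - min (s / 2) (1 / 2), ⟨by linarith [min_le_right (s / 2) (1 / 2)], by linarith⟩,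
    fun x hx => ?_, fun x hx => ?_⟩
  · refine sub_pos.1 (h0 ⟨?_, hx.1, by linarith [min_le_right (r / 2) (1 / 2), hx.2]⟩)
    rw [Metric.mem_ball, Real.dist_eq, abs_lt]
    constructor <;> linarith [min_le_left (r / 2) (1 / 2), hx.1, hx.2]
  · refine sub_pos.1 (h1 ⟨?_, by linarith [min_le_right (s / 2) (1 / 2), hx.1], hx.2⟩)
    rw [Metric.mem_ball, Real.dist_eq, abs_lt]
    constructor <;> linarith [min_le_left (s / 2) (1 / 2), hx.1, hx.2]

/-- The curvature of a local minimizer is Lipschitz in arclength. -/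
theorem exists_lipschitzWith_curv (D : TangentData γ p q) {lam : ℝ} {ψ σ : ℝ → ℝ} {K : ℝ≥0}
    (hψ : IsObstacle ψ) (hLip : LipschitzWith K ψ) (hlam : 0 ≤ lam)
    (hγ : IsLocalMinimizer lam ψ γ) (hσ : ∀ x ∈ Icc (0 : ℝ) 1, σ (arcl p x) = x) :
    ∃ (C : ℝ≥0) (Λ : ℝ → Plane), LipschitzWith C Λ ∧
      ∀ᵐ u, u ∈ Ioo 0 (arcl p 1) → curv p (σ u) = Λ u := by
  obtain ⟨c, hc, d, hd, hslc, hsld⟩ := exists_slack hψ hγ.1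
  have hγc : ContinuousOn γ (Icc 0 1) := hγ.1.1.contDiffOn.continuousOn
  have hobs := hγ.1.2.2.2
  have hpos : ∀ {x : ℝ}, 0 < x → 0 < arcl p x := fun hx => by
    have := D.strictMono_arcl hx
    rwa [arcl_zero] at this
  -- Transports the first variation from the parameter x to arclength u, with σ inverting the
  -- arclength function.
  have hcv : ∀ w : Plane, ∀ φ : ℝ → ℝ, ∫ u in Ioo 0 (arcl p 1),
      (deriv (deriv φ) u * (2 * inner ℝ (curv p (σ u)) w) +
        deriv φ u * ((lam - 3 * ‖curv p (σ u)‖ ^ 2) * inner ℝ (utan p (σ u)) w)) =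
      ∫ x in Ioo (0 : ℝ) 1, ‖p x‖ *
        (deriv (deriv φ) (arcl p x) * (2 * inner ℝ (curv p x) w) +
          deriv φ (arcl p x) * ((lam - 3 * ‖curv p x‖ ^ 2) * inner ℝ (utan p x) w)) := by
    intro w φ
    rw [D.setIntegral_arcl zero_le_one]
    refine setIntegral_congr_fun measurableSet_Ioo fun x hx => ?_
    simp only [hσ x (Ioo_subset_Icc_self hx), smul_eq_mul]
  -- The maximum with 1 keeps M positive when ψ has Lipschitz constant 0; enlarging M only narrows
  -- the cone.
  refine exists_lipschitzWith_of_inequality (κ := fun u => curv p (σ u))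
    (T := fun u => utan p (σ u)) (M := max (K : ℝ) 1) (lam := lam) (c := arcl p c) (d := arcl p d)
    (lt_max_of_lt_right one_pos) (hpos hc.1) (D.strictMono_arcl hc.2) (hpos hd.1)
    (D.strictMono_arcl hd.2) (fun u _ => D.norm_utan _) ?_ ?_ ?_ ?_ ?_
  · rw [D.integrableOn_arcl_iff zero_le_one]
    have : IntegrableOn (fun x => ‖p x‖ • curv p x) (Ioo 0 1) := by
      rw [IntegrableOn, integrable_plane_iff]
      exact fun i => integrableOn_continuous_mul (integrable_plane_iff.1 D.integrableOn_curv i)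
        D.continuous.norm
    refine this.congr_fun (fun x hx => ?_) measurableSet_Ioo
    simp only [hσ x (Ioo_subset_Icc_self hx)]
  · intro w
    rw [D.integrableOn_arcl_iff zero_le_one]
    have : IntegrableOn (fun x => (‖p x‖ * inner ℝ (utan p x) w) * (lam - 3 * ‖curv p x‖ ^ 2))
        (Ioo 0 1) :=
      integrableOn_continuous_mul
        ((integrable_const lam).sub (D.integrableOn_sq_curv.const_mul 3))
        (D.continuous.norm.mul (D.continuous_utan.inner continuous_const))
    refine this.congr_fun (fun x hx => ?_) measurableSet_Ioo
    simp only [hσ x (Ioo_subset_Icc_self hx), smul_eq_mul]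
    ring
  · intro w hw φ hφ hφ0
    rw [hcv]
    refine D.first_variation_nonneg hlam hγ hφ w (admissible_of_nonneg hLip hobs hφ0 ?_)
    exact (mul_le_mul_of_nonneg_right (le_max_left _ _) (abs_nonneg _)).trans hw
  · intro w φ hφ
    rw [hcv]
    refine D.first_variation_nonneg hlam hγ (hφ.mono le_rfl (D.strictMono_arcl hc.2).le) w
      (admissible_of_slack hLip hγc hobs hφ w (Icc_subset_Icc_right hc.2.le) hslc fun x hx hne => ?_)
    have := not_not.1 (mt hφ.eq_zero hne)
    exact ⟨hx.1, (D.strictMono_arcl.lt_iff_lt.1 this.2).le⟩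
  · intro w φ hφ
    rw [hcv]
    refine D.first_variation_nonneg hlam hγ (hφ.mono (hpos hd.1).le le_rfl) w
      (admissible_of_slack hLip hγc hobs hφ w (Icc_subset_Icc_left hd.1.le) hsld fun x hx hne => ?_)
    have := not_not.1 (mt hφ.eq_zero hne)
    exact ⟨(D.strictMono_arcl.lt_iff_lt.1 this.1).le, hx.2⟩

/-- Reconstruction of the unit tangent and the curve from a continuous curvature vector. -/
theorem utan_and_curve_eq (D : TangentData γ p q) {σ : ℝ → ℝ} {Λ : ℝ → Plane}
    (hσ : ∀ x ∈ Icc (0 : ℝ) 1, σ (arcl p x) = x)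
    (hΛ : ∀ᵐ u, u ∈ Ioo 0 (arcl p 1) → curv p (σ u) = Λ u) {x : ℝ} (hx : x ∈ Icc (0 : ℝ) 1) :
    utan p x = utan p 0 + (∫ u in (0 : ℝ)..arcl p x, Λ u) ∧
      γ x = γ 0 + ∫ u in (0 : ℝ)..arcl p x, (utan p 0 + ∫ t in (0 : ℝ)..u, Λ t) := by
  have hnn : ∀ {y : ℝ}, 0 ≤ y → 0 ≤ arcl p y := fun hy => by
    have := D.strictMono_arcl.monotone hy
    rwa [arcl_zero] at this
  have hT : ∀ y ∈ Icc (0 : ℝ) 1, utan p y = utan p 0 + ∫ u in (0 : ℝ)..arcl p y, Λ u := by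
    intro y hy
    have h1 := (integrable_and_integral_eq_plane hy.1 (D.absolutelyContinuousOnInterval_utan hy.1)
      (g := fun z => ‖p z‖ • curv p z) (by
        filter_upwards [D.ae_hasDerivAt_utan] with z hz _
        exact hz.1)).2
    have h2 : ∫ u in (0 : ℝ)..arcl p y, Λ u = ∫ z in (0 : ℝ)..y, ‖p z‖ • curv p z := by
      rw [intervalIntegral.integral_of_le (hnn hy.1), integral_Ioc_eq_integral_Ioo,
        intervalIntegral.integral_of_le hy.1, integral_Ioc_eq_integral_Ioo]
      have h3 : ∫ u in Ioo 0 (arcl p y), Λ u = ∫ u in Ioo 0 (arcl p y), curv p (σ u) := by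
        refine integral_congr_ae ?_
        rw [EventuallyEq, ae_restrict_iff' measurableSet_Ioo]
        filter_upwards [hΛ] with u hu hum
        exact (hu ⟨hum.1, hum.2.trans_le (D.strictMono_arcl.monotone hy.2)⟩).symm
      rw [h3, D.setIntegral_arcl hy.1]
      refine setIntegral_congr_fun measurableSet_Ioo fun z hz => ?_
      simp only [hσ z ⟨hz.1.le, hz.2.le.trans hy.2⟩]
    rw [h2, h1, add_sub_cancel]
  refine ⟨hT x hx, ?_⟩
  rw [D.curve_eq x hx]
  congr 1
  rw [intervalIntegral.integral_of_le (hnn hx.1), integral_Ioc_eq_integral_Ioo,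
    intervalIntegral.integral_of_le hx.1, integral_Ioc_eq_integral_Ioo, D.setIntegral_arcl hx.1]
  refine setIntegral_congr_fun measurableSet_Ioo fun z hz => ?_
  simp only [← hT z ⟨hz.1.le, hz.2.le.trans hx.2⟩, D.smul_utan]

end TangentData

/-! ### Rotation and the signed curvature -/

theorem rot_sub (v w : Plane) : rot (v - w) = rot v - rot w := by
  ext i
  fin_cases i
  · simp [rot]
    ring
  · simp [rot]

theorem norm_rot (v : Plane) : ‖rot v‖ = ‖v‖ := by
  rw [EuclideanSpace.norm_eq, EuclideanSpace.norm_eq]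
  simp [rot, Fin.sum_univ_two, add_comm]

/-- On [0, L] both factors are bounded and Lipschitz, T because its derivative Λ is bounded there.
Globally Λ may be unbounded, hence the restriction and extension. -/
theorem exists_lipschitzWith_inner_rot {Λ T : ℝ → Plane} {K : ℝ≥0} {L : ℝ}
    (hΛ : LipschitzWith K Λ) (hT : ∀ u, HasDerivAt T (Λ u) u) :
    ∃ (C : ℝ≥0) (k : ℝ → ℝ), LipschitzWith C k ∧
      EqOn k (fun u => inner ℝ (Λ u) (rot (T u))) (Icc 0 L) := by
  have hTc : Continuous T := continuous_iff_continuousAt.2 fun u => (hT u).continuousAt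
  obtain ⟨C1, hC1⟩ := (isCompact_Icc (a := 0) (b := L)).exists_bound_of_continuousOn
    hΛ.continuous.continuousOn
  obtain ⟨C2, hC2⟩ := (isCompact_Icc (a := 0) (b := L)).exists_bound_of_continuousOn
    hTc.continuousOn
  have hTl : ∀ x ∈ Icc 0 L, ∀ y ∈ Icc 0 L, ‖T x - T y‖ ≤ C1 * ‖x - y‖ := fun x hx y hy =>
    (convex_Icc 0 L).norm_image_sub_le_of_norm_hasDerivWithin_le
      (fun z _ => (hT z).hasDerivWithinAt) hC1 hy hx
  have hlip : LipschitzOnWith (Real.toNNReal (K * C2 + C1 * C1))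
      (fun u => inner ℝ (Λ u) (rot (T u))) (Icc 0 L) := by
    refine LipschitzOnWith.of_dist_le_mul fun x hx y hy => ?_
    have e : (inner ℝ (Λ x) (rot (T x)) : ℝ) - inner ℝ (Λ y) (rot (T y)) =
        inner ℝ (Λ x - Λ y) (rot (T x)) + inner ℝ (Λ y) (rot (T x - T y)) := by
      rw [rot_sub, inner_sub_left, inner_sub_right]
      ring
    have hC10 : 0 ≤ C1 := (norm_nonneg _).trans (hC1 x hx)
    rw [Real.dist_eq, e]
    calc |(inner ℝ (Λ x - Λ y) (rot (T x)) + inner ℝ (Λ y) (rot (T x - T y)) : ℝ)|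
        ≤ ‖Λ x - Λ y‖ * ‖T x‖ + ‖Λ y‖ * ‖T x - T y‖ := by
          refine (abs_add_le _ _).trans (add_le_add ?_ ?_)
          · simpa only [norm_rot] using abs_real_inner_le_norm (Λ x - Λ y) (rot (T x))
          · simpa only [norm_rot] using abs_real_inner_le_norm (Λ y) (rot (T x - T y))
      _ ≤ K * dist x y * C2 + C1 * (C1 * ‖x - y‖) := by
          have h1 := hΛ.dist_le_mul x y
          rw [dist_eq_norm] at h1
          gcongr
          · exact hC2 x hx
          · exact hC1 y hy
          · exact hTl x hx y hy
      _ = (K * C2 + C1 * C1) * dist x y := by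
          rw [dist_eq_norm]
          ring
      _ ≤ _ := by
          gcongr
          exact Real.le_coe_toNNReal _
  obtain ⟨k, hk, hke⟩ := hlip.extend_real
  exact ⟨_, k, hk, fun u hu => (hke hu).symm⟩

end Elastica

end

/-! ### The main theorem -/

theorem corollary3p8 (ψ : ℝ → ℝ) (hψ : IsObstacle ψ) (hLip : ∃ K : ℝ≥0, LipschitzWith K ψ)
    (lam : ℝ) (hlam : 0 ≤ lam) (γ : ℝ → Plane) (hγ : IsLocalMinimizer lam ψ γ) :
    MemSobolev 3 ⊤ 0 (curveLength γ) (arclengthParam γ) ∧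
      MemSobolev 1 ⊤ 0 (curveLength γ) (signedCurvature (arclengthParam γ)) := by
  obtain ⟨K, hK⟩ := hLip
  obtain ⟨p, q, D⟩ := hγ.1.1.exists_tangentData
  have hσ := fun x hx => D.invFunOn_arclength (x := x) hx
  obtain ⟨C, Λ, hΛ, hae⟩ := D.exists_lipschitzWith_curv hψ hK hlam hγ hσ
  have hL : curveLength γ = arcl p 1 := D.arclength_eq (by simp)
  have hLpos : 0 ≤ arcl p 1 := D.arcl_one_pos.le
  rw [hL]
  -- T and Γ are tangent and curve rebuilt from Λ on the whole line. They agree with the arclength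
  -- data on (0, L), which is all that Sobolev membership sees and, the interval being open, also
  -- determines derivatives.
  set T : ℝ → Plane := fun u => utan p 0 + ∫ t in (0 : ℝ)..u, Λ t with hTdef
  set Γ : ℝ → Plane := fun u => γ 0 + ∫ t in (0 : ℝ)..u, T t with hΓdef
  have hT : ∀ u, HasDerivAt T (Λ u) u := fun u =>
    ((hΛ.continuous.integral_hasStrictDerivAt 0 u).hasDerivAt).const_add _
  have hTc : Continuous T := continuous_iff_continuousAt.2 fun u => (hT u).continuousAt
  have hΓ : ∀ u, HasDerivAt Γ (T u) u := fun u =>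
    ((hTc.integral_hasStrictDerivAt 0 u).hasDerivAt).const_add _
  have hparam : ∀ u ∈ Ioo 0 (arcl p 1), Γ u = arclengthParam γ u ∧ ‖T u‖ = 1 := by
    intro u hu
    rw [← D.image_arcl_Ioo zero_le_one] at hu
    obtain ⟨x, hx, rfl⟩ := hu
    have hx' := Ioo_subset_Icc_self hx
    have h := D.utan_and_curve_eq hσ hae hx'
    refine ⟨?_, ?_⟩
    · rw [arclengthParam, hσ x hx']
      exact h.2.symm
    · rw [show T (arcl p x) = utan p x from h.1.symm]
      exact D.norm_utan x
  refine ⟨MemSobolev.congr (f := Γ) ?_ fun u hu => (hparam u hu).1, ?_⟩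
  · exact MemSobolev.of_hasDerivAt hLpos hΓ hTc (MemSobolev.of_hasDerivAt hLpos hT hΛ.continuous
      (memSobolev_one_top_plane_of_lipschitzWith hLpos hΛ))
  · obtain ⟨C', k, hk, hke⟩ := exists_lipschitzWith_inner_rot (L := arcl p 1) hΛ hT
    refine MemSobolev.congr (memSobolev_one_top_of_lipschitzWith hLpos hk) fun u hu => ?_
    rw [hke (Ioo_subset_Icc_self hu)]
    have hd : ∀ y ∈ Ioo 0 (arcl p 1), deriv (arclengthParam γ) y = T y := by
      intro y hy
      refine ((hΓ y).congr_of_eventuallyEq ?_).deriv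
      filter_upwards [Ioo_mem_nhds hy.1 hy.2] with z hz
      exact (hparam z hz).1.symm
    have ha : ∀ y ∈ Ioo 0 (arcl p 1), arcDeriv (arclengthParam γ) (arclengthParam γ) y = T y := by
      intro y hy
      rw [arcDeriv, hd y hy, (hparam y hy).2, inv_one, one_smul]
    have hc : curvatureVector (arclengthParam γ) u = Λ u := by
      have he : arcDeriv (arclengthParam γ) (arclengthParam γ) =ᶠ[nhds u] T := by
        filter_upwards [Ioo_mem_nhds hu.1 hu.2] with z hz
        exact ha z hz
      rw [curvatureVector, arcDeriv, hd u hu, (hparam u hu).2, inv_one, one_smul, he.deriv_eq,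
        (hT u).deriv]
    rw [signedCurvature, hc, ha u hu]
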